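/- Let $P$ be a subsemigroup of a discrete group $G$, with identity element $e$. For $p\in P$ let $V_p$ be the isometry $\delta_x\mapsto\delta_{px}$ of $\ell^2(P)$. Let $C^*_\lambda(P)\subseteq\mathcal L(\ell^2(P))$ be the C*-algebra generated by $\{V_p : p\in P\}$, and let $D_\lambda(P)=C^*_\lambda(P)\cap\ell^\infty(P)$. Let $I_V$ be the set of all products $V_{p_1}^*V_{q_1}\cdots V_{p_n}^*V_{q_n}$ ($n\ge 1$, $p_i,q_i\in P$), and for $0\ne V=V_{p_1}^*V_{q_1}\cdots V_{p_n}^*V_{q_n}\in I_V$ put $\sigma(V)=p_1^{-1}q_1\cdots p_n^{-1}q_n\in G$ (this depends only on $V$). Partial action. For $g\in G$ let $D_{g^{-1}}$ be the closed linear span of $\{V^*V : 0\ne V\in I_V,\ \sigma(V)=g\}$. It is a closed ideal of $D_\lambda(P)$, with $D_e=D_\lambda(P)$. The *-isomorphisms $\alpha^*_g: D_{g^{-1}}\to D_g$ with $V^*V\mapsto VV^*$ for $0\ne V\in I_V$, $\sigma(V)=g$ (that is, conjugation with the left translation unitary $\lambda_g$ of $\ell^2(G)\supseteq\ell^2(P)$)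 form a partial action of $G$ on $D_\lambda(P)$. Reduced crossed product. Let $X$ be the space of characters of $D_\lambda(P)$ and $U_g=\{\chi\in X : \chi|_{D_g}\ne 0\}$. For $\chi\in U_{g^{-1}}$ let $g.\chi\in U_g$ be the unique character of $D_\lambda(P)$ that extends $\chi\circ\alpha^*_{g^{-1}}: D_g\to\mathbb C$. On $H=\ell^2(G,\ell^2(X))$, with $X$ viewed as a discrete set, let $D_\lambda(P)$ act by $\mu(f)(\delta_h\otimes\delta_\chi)=(h.\chi)(f)\,\delta_h\otimes\delta_\chi$ if $\chi\in U_{h^{-1}}$, and $\mu(f)(\delta_h\otimes\delta_\chi)=0$ otherwise. For $g\in G$ let $E_g$ be the orthogonal projection of $H$ onto the closed linear span of $\mu(D_{g^{-1}})H$, and let $u_g=(\lambda_g\otimes I)E_g$, where $\lambda$ is the left regular representation of $G$. The reduced partial crossed product $D_\lambda(P)\rtimes_r G\subseteq\mathcal L(H)$ is the C*-algebra generated by all $f u_g:=\mu(f)u_g$ with $g\in G$ and $f\in D_g$; equivalently, it is the completion of the *-algebra of sums $\sum_g f_g\delta_g$, $f_g\in D_g$, in the norm of the *-representation $\sum_g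 f_g\delta_g\mapsto\sum_g\mu(f_g)u_g$. Proposition. There is a *-isomorphism $C^*_\lambda(P)\cong D_\lambda(P)\rtimes_r G$ that maps $V_p$ to $V_pV_p^*\,u_p$ for every $p\in P$ (where $V_pV_p^*\in D_p$), and it is the only *-isomorphism with this property. -/

import Mathlib

open scoped InnerProductSpace ENNReal

noncomputable section

namespace SemigroupCStar

/-! ### Operators on `ℓ²(ι)` -/

/-- The Hilbert space `ℓ²(ι)`. -/
abbrev L2 (ι : Type*) : Type _ := lp (fun _ : ι => ℂ) 2

open Classical in
/-- The canonical orthonormal basis vector `δ_i` of `ℓ²(ι)`. -/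
def delta {ι : Type*} (i : ι) : L2 ι := lp.single 2 i (1 : ℂ)

theorem orthonormal_delta {ι : Type*} : Orthonormal ℂ (delta : ι → L2 ι) := by
  classical
  rw [orthonormal_iff_ite]
  intro i j
  simp only [delta, lp.inner_single_left, lp.single_apply]
  by_cases h : i = j
  · subst h; simp
  · simp [h]

/-- For an injective map `f : ι → κ`, the isometry `ℓ²(ι) → ℓ²(κ)` with `δ_i ↦ δ_{f i}`. -/
def shift {ι κ : Type*} (f : ι → κ) (hf : Function.Injective f) : L2 ι →L[ℂ] L2 κ :=
  (orthonormal_delta.comp f hf).orthogonalFamily.linearIsometry.toContinuousLinearMap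

/-- The operator of multiplication by a bounded function on `ℓ²(ι)`. -/
def mulOp {ι : Type*} (w : lp (fun _ : ι => ℂ) ∞) : L2 ι →L[ℂ] L2 ι :=
  LinearMap.mkContinuous
    { toFun := fun ξ => ⟨fun i => w i * ξ i,
        (((lp.memℓp ξ).const_mul (‖w‖ : ℂ))).mono' (fun i => by
          simpa using mul_le_mul_of_nonneg_right
            (lp.norm_apply_le_norm ENNReal.top_ne_zero w i) (norm_nonneg (ξ i)))⟩
      map_add' := fun ξ η => by ext i; exact mul_add _ _ _
      map_smul' := fun c ξ => by ext i; exact mul_left_comm _ _ _ }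
    ‖w‖ (fun ξ => by
      have h := lp.norm_mono (p := 2) (by simp) (x := (⟨fun i => w i * ξ i,
        (((lp.memℓp ξ).const_mul (‖w‖ : ℂ))).mono' (fun i => by
          simpa using mul_le_mul_of_nonneg_right
            (lp.norm_apply_le_norm ENNReal.top_ne_zero w i) (norm_nonneg (ξ i)))⟩ : L2 ι))
        (y := ((‖w‖ : ℂ) • ξ : L2 ι)) (fun i => by
          rw [lp.coeFn_smul, Pi.smul_apply, norm_smul]
          simpa using mul_le_mul_of_nonneg_right
            (lp.norm_apply_le_norm ENNReal.top_ne_zero w i) (norm_nonneg (ξ i)))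
      rw [norm_smul] at h
      simpa using h)

@[simp] theorem mulOp_apply {ι : Type*} (w : lp (fun _ : ι => ℂ) ∞) (ξ : L2 ι) (i : ι) :
    mulOp w ξ i = w i * ξ i := rfl

@[simp] theorem shift_delta {ι κ : Type*} (f : ι → κ) (hf : Function.Injective f) (i : ι) :
    shift f hf (delta i) = delta (f i) := by
  classical
  simp only [shift, LinearIsometry.coe_toContinuousLinearMap]
  have := (orthonormal_delta.comp f hf).orthogonalFamily.linearIsometry_apply_single
    (i := i) (1 : ℂ)
  simp only [LinearIsometry.toSpanSingleton_apply, one_smul, Function.comp] at this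
  rw [← this]
  unfold delta
  congr!

theorem inner_delta {ι : Type*} (i : ι) (ξ : L2 ι) : ⟪delta i, ξ⟫_ℂ = ξ i := by
  classical
  simp [delta, lp.inner_single_left]

theorem delta_self {ι : Type*} (i : ι) : (delta i : L2 ι) i = 1 := by
  classical
  simp [delta]

theorem delta_ne {ι : Type*} {i j : ι} (h : j ≠ i) : (delta i : L2 ι) j = 0 := by
  classical
  simp [delta, h]

theorem delta_ne_zero {ι : Type*} (i : ι) : (delta i : L2 ι) ≠ 0 := fun h => by
  simpa [h] using delta_self i

theorem ext_delta {ι : Type*} {F : Type*} [NormedAddCommGroup F] [NormedSpace ℂ F]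
    {S T : L2 ι →L[ℂ] F} (h : ∀ i, S (delta i) = T (delta i)) : S = T := by
  classical
  refine lp.ext_continuousLinearMap (by simp) fun i => ?_
  ext
  have := h i
  simp only [delta] at this
  simp only [ContinuousLinearMap.comp_apply, lp.singleContinuousLinearMap_apply]
  convert this

theorem adjoint_delta_apply {ι κ : Type*} (T : L2 ι →L[ℂ] L2 κ) (i : ι) (k : κ) :
    (ContinuousLinearMap.adjoint T (delta k)) i = star ((T (delta i)) k) := by
  rw [← inner_delta, ContinuousLinearMap.adjoint_inner_right, ← inner_delta,
    ← inner_conj_symm]; rfl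

theorem mulOp_delta {ι : Type*} (w : lp (fun _ : ι => ℂ) ∞) (i : ι) :
    mulOp w (delta i) = w i • delta i := by
  ext j
  by_cases h : j = i
  · subst h; simp
  · simp [delta_ne h]

theorem mulOp_star {ι : Type*} (w : lp (fun _ : ι => ℂ) ∞) :
    star (mulOp w) = mulOp (star w) := by
  refine ext_delta fun i => ?_
  ext j
  rw [ContinuousLinearMap.star_eq_adjoint, adjoint_delta_apply, mulOp_delta, mulOp_delta]
  by_cases h : j = i
  · subst h; simp [delta_self]
  · simp [delta_ne h, delta_ne (Ne.symm h)]

theorem mulOp_mul {ι : Type*} (w w' : lp (fun _ : ι => ℂ) ∞) :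
    mulOp w * mulOp w' = mulOp (w * w') := by
  ext ξ i; simp [mul_assoc]

/-- The algebra `ℓ^∞(ι)`, acting on `ℓ²(ι)` by multiplication operators. -/
def ellInfty (ι : Type*) : StarSubalgebra ℂ (L2 ι →L[ℂ] L2 ι) where
  carrier := Set.range (mulOp (ι := ι))
  mul_mem' := by
    rintro _ _ ⟨w, rfl⟩ ⟨w', rfl⟩
    exact ⟨w * w', (mulOp_mul w w').symm⟩
  add_mem' := by
    rintro _ _ ⟨w, rfl⟩ ⟨w', rfl⟩
    exact ⟨w + w', by ext ξ i; simp [add_mul]⟩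
  algebraMap_mem' := fun c => ⟨algebraMap ℂ _ c, by
    rw [Algebra.algebraMap_eq_smul_one, Algebra.algebraMap_eq_smul_one]
    ext ξ i; simp⟩
  star_mem' := by
    rintro _ ⟨w, rfl⟩
    exact ⟨star w, (mulOp_star w).symm⟩

/-- The diagonal entries of an operator on `ℓ²(ι)`, as a bounded function. -/
def diagEntries {ι : Type*} (T : L2 ι →L[ℂ] L2 ι) : lp (fun _ : ι => ℂ) ∞ :=
  ⟨fun i => T (delta i) i, memℓp_infty ⟨‖T‖, by
    rintro _ ⟨i, rfl⟩
    refine (lp.norm_apply_le_norm (by simp) (T (delta i)) i).trans ((T.le_opNorm _).trans ?_)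
    rw [orthonormal_delta.1 i, mul_one]⟩⟩

theorem diagEntries_apply {ι : Type*} (T : L2 ι →L[ℂ] L2 ι) (i : ι) :
    diagEntries T i = T (delta i) i := rfl

theorem norm_mulOp_le {ι : Type*} (w : lp (fun _ : ι => ℂ) ∞) : ‖mulOp w‖ ≤ ‖w‖ :=
  LinearMap.mkContinuous_norm_le _ (norm_nonneg _) _

/-- The conditional expectation of the bounded operators onto the diagonal operators. -/
def expect (ι : Type*) : (L2 ι →L[ℂ] L2 ι) →L[ℂ] (L2 ι →L[ℂ] L2 ι) :=
  LinearMap.mkContinuous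
    { toFun := fun T => mulOp (diagEntries T)
      map_add' := fun S T => by ext ξ i; simp [diagEntries_apply, add_mul]
      map_smul' := fun c T => by ext ξ i; simp [diagEntries_apply, mul_assoc] }
    1 (fun T => by
      rw [one_mul]
      refine (norm_mulOp_le _).trans (lp.norm_le_of_forall_le (norm_nonneg _) fun i => ?_)
      refine (lp.norm_apply_le_norm (by simp) (T (delta i)) i).trans ((T.le_opNorm _).trans ?_)
      rw [orthonormal_delta.1 i, mul_one])

theorem expect_apply {ι : Type*} (T : L2 ι →L[ℂ] L2 ι) :
    expect ι T = mulOp (diagEntries T) := rfl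

theorem expect_of_mem {ι : Type*} {T : L2 ι →L[ℂ] L2 ι} (hT : T ∈ ellInfty ι) :
    expect ι T = T := by
  obtain ⟨w, rfl⟩ := hT
  ext ξ i
  simp [expect_apply, diagEntries_apply, delta_self]

theorem isClosed_ellInfty (ι : Type*) : IsClosed (ellInfty ι : Set (L2 ι →L[ℂ] L2 ι)) := by
  have : (ellInfty ι : Set (L2 ι →L[ℂ] L2 ι)) = {T | expect ι T = T} := by
    ext T
    exact ⟨fun h => expect_of_mem h, fun h => ⟨diagEntries T, h⟩⟩
  rw [this]
  exact isClosed_eq (expect ι).continuous continuous_id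

theorem ellInfty_comm {ι : Type*} {S T : L2 ι →L[ℂ] L2 ι} (hS : S ∈ ellInfty ι)
    (hT : T ∈ ellInfty ι) : S * T = T * S := by
  obtain ⟨w, rfl⟩ := hS
  obtain ⟨w', rfl⟩ := hT
  rw [mulOp_mul, mulOp_mul, mul_comm]

/-! ### Partial actions on C*-algebras and the reduced crossed product -/

/-- A partial action of a (discrete) group `G` on a C*-algebra `A`: closed two-sided ideals `D_g`
and *-isomorphisms `α_g : D_{g⁻¹} → D_g` such that `D_1 = A`, `α_1 = id`, and `α_{gh}` extends
`α_g ∘ α_h`, the latter being defined on `α_h⁻¹(D_h ∩ D_{g⁻¹})`. -/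
structure PartialAction (G A : Type*) [Group G] [NonUnitalCStarAlgebra A] where
  ideal : G → NonUnitalStarSubalgebra ℂ A
  isClosed_ideal : ∀ g, IsClosed (ideal g : Set A)
  mul_mem_left : ∀ (g : G) (a x : A), x ∈ ideal g → a * x ∈ ideal g
  mul_mem_right : ∀ (g : G) (a x : A), x ∈ ideal g → x * a ∈ ideal g
  act : ∀ g, ideal g⁻¹ ≃⋆ₐ[ℂ] ideal g
  ideal_one : ideal 1 = ⊤
  act_one : ∀ x : ideal 1⁻¹, (act 1 x : A) = x
  act_act : ∀ (g h : G) (x : ideal h⁻¹) (hx : (act h x : A) ∈ ideal g⁻¹),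
    ∃ hx' : (x : A) ∈ ideal (g * h)⁻¹,
      (act (g * h) ⟨x, hx'⟩ : A) = act g ⟨act h x, hx⟩

namespace PartialAction

variable {G A : Type*} [Group G] [NonUnitalCommCStarAlgebra A] (α : PartialAction G A)

/-- The spectrum of the ideal `D_g`, as a subset `U_g` of the spectrum of `A`. -/
def U (g : G) : Set (WeakDual.characterSpace ℂ A) := {χ | ∃ a ∈ α.ideal g, χ a ≠ 0}

theorem exists_dual (g : G) {χ : WeakDual.characterSpace ℂ A} (hχ : χ ∈ α.U g⁻¹) :
    ∃ ψ : WeakDual.characterSpace ℂ A, ∀ a : α.ideal g⁻¹, ψ (α.act g a) = χ a := by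
  obtain ⟨a, ha, hne⟩ := hχ
  have := α.isClosed_ideal g
  have := α.isClosed_ideal g⁻¹
  set b : α.ideal g := α.act g ⟨a, ha⟩ with hb
  let F : A →ₗ[ℂ] α.ideal g :=
    { toFun := fun f => ⟨f * b, α.mul_mem_left g f b b.2⟩
      map_add' := fun _ _ => Subtype.ext (add_mul _ _ _)
      map_smul' := fun c x => Subtype.ext (smul_mul_assoc _ _ _) }
  have key : ∀ x y : A, (α.act g).symm (F (x * y)) * ⟨a, ha⟩ =
      (α.act g).symm (F x) * (α.act g).symm (F y) := by
    intro x y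
    rw [← (α.act g).symm_apply_apply ⟨a, ha⟩, ← map_mul, ← map_mul]
    congr 1
    refine Subtype.ext ?_
    change x * y * b * (α.act g ⟨a, ha⟩ : A) = x * b * (y * b)
    rw [← hb, mul_assoc, mul_mul_mul_comm]
  let φ : A →L[ℂ] ℂ := LinearMap.mkContinuous
    { toFun := fun f => (χ a)⁻¹ * χ ((α.act g).symm (F f) : A)
      map_add' := fun _ _ => by simp only [map_add, mul_add, NonUnitalStarSubalgebra.coe_add]
      map_smul' := fun c x => by
        simp only [map_smul, NonUnitalStarSubalgebra.coe_smul, smul_eq_mul, RingHom.id_apply]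
        ring }
    (‖(χ a)⁻¹‖ * (‖WeakDual.CharacterSpace.toCLM χ‖ * ‖(b : A)‖)) (fun f => by
      change ‖(χ a)⁻¹ * χ ((α.act g).symm (F f) : A)‖ ≤ _
      rw [norm_mul, mul_assoc]
      refine mul_le_mul_of_nonneg_left ?_ (norm_nonneg _)
      refine ((WeakDual.CharacterSpace.toCLM χ).le_opNorm _).trans ?_
      rw [mul_assoc]
      refine mul_le_mul_of_nonneg_left ?_ (norm_nonneg _)
      have h1 : ‖(α.act g).symm (F f)‖ = ‖F f‖ := StarAlgEquiv.norm_map _ _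
      have h2 : ‖F f‖ ≤ ‖f‖ * ‖(b : A)‖ := norm_mul_le f (b : A)
      calc _ = ‖(α.act g).symm (F f)‖ := rfl
        _ ≤ _ := by rw [h1, mul_comm]; exact h2)
  have hφ : ∀ f, φ f = (χ a)⁻¹ * χ ((α.act g).symm (F f) : A) := fun _ => rfl
  have hext : ∀ x : α.ideal g⁻¹, φ (α.act g x) = χ x := by
    intro x
    have : F (α.act g x) = α.act g (x * ⟨a, ha⟩) := by
      rw [map_mul]; rfl
    rw [hφ, this, StarAlgEquiv.symm_apply_apply, NonUnitalStarSubalgebra.coe_mul, map_mul]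
    field_simp
  have hmul : ∀ x y : A, φ (x * y) = φ x * φ y := by
    intro x y
    have h := congrArg (fun z : α.ideal g⁻¹ => χ (z : A)) (key x y)
    simp only [NonUnitalStarSubalgebra.coe_mul, map_mul] at h
    rw [hφ, hφ, hφ]
    field_simp
    linear_combination h
  refine ⟨⟨φ, ⟨fun h0 => hne ?_, hmul⟩⟩, hext⟩
  have h0' : φ = 0 := h0
  rw [← hext ⟨a, ha⟩, h0']
  rfl

/-- The dual partial action on the spectrum of `A`: for `χ ∈ U_{g⁻¹}`, the character `g.χ` is
the unique character of `A` whose restriction to `D_g` is `χ ∘ α_g⁻¹`. -/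
def dual (g : G) (χ : WeakDual.characterSpace ℂ A) (hχ : χ ∈ α.U g⁻¹) :
    WeakDual.characterSpace ℂ A := (α.exists_dual g hχ).choose

theorem dual_act (g : G) (χ : WeakDual.characterSpace ℂ A) (hχ : χ ∈ α.U g⁻¹)
    (a : α.ideal g⁻¹) : α.dual g χ hχ (α.act g a) = χ a := (α.exists_dual g hχ).choose_spec a

theorem dual_unique (g : G) (χ : WeakDual.characterSpace ℂ A) (hχ : χ ∈ α.U g⁻¹)
    (ψ : WeakDual.characterSpace ℂ A) (hψ : ∀ a : α.ideal g⁻¹, ψ (α.act g a) = χ a) :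
    ψ = α.dual g χ hχ := by
  obtain ⟨a, ha, hne⟩ := id hχ
  refine WeakDual.CharacterSpace.ext fun f => ?_
  set b := α.act g ⟨a, ha⟩ with hb
  obtain ⟨c, hc⟩ : ∃ c, α.act g c = ⟨f * b, α.mul_mem_left g f b b.2⟩ :=
    ⟨(α.act g).symm _, StarAlgEquiv.apply_symm_apply _ _⟩
  have h1 : ψ (f * b) = α.dual g χ hχ (f * b) := by
    have e1 := hψ c
    have e2 := α.dual_act g χ hχ c
    rw [hc] at e1 e2
    exact e1.trans e2.symm
  rw [map_mul, map_mul, hb, hψ, dual_act] at h1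
  exact mul_right_cancel₀ hne h1

/-- The Hilbert space `ℓ²(G, ℓ²(X)) = ℓ²(G × X)`, where `X` is the spectrum of `A`, viewed as
a discrete set. -/
abbrev H (_ : PartialAction G A) : Type _ := L2 (G × WeakDual.characterSpace ℂ A)

open Classical in
/-- The function `(h, χ) ↦ f(h.χ)` for `χ ∈ U_{h⁻¹}`, and `0` for `χ ∉ U_{h⁻¹}`. -/
def weight (f : A) (x : G × WeakDual.characterSpace ℂ A) : ℂ :=
  if h : x.2 ∈ α.U x.1⁻¹ then α.dual x.1 x.2 h f else 0

theorem norm_character_le (χ : WeakDual.characterSpace ℂ A) (f : A) : ‖χ f‖ ≤ ‖f‖ := by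
  set C := ‖WeakDual.CharacterSpace.toCLM χ‖ with hC
  have h1 : ∀ a, ‖χ a‖ ≤ C * ‖a‖ := fun a => (WeakDual.CharacterSpace.toCLM χ).le_opNorm a
  have h2 : C ≤ 1 := by
    by_contra! hlt
    have h3 : ∀ a, ‖χ a‖ ≤ √C * ‖a‖ := fun a => by
      have h4 : ‖χ a‖ ^ 2 ≤ C * ‖a‖ ^ 2 := by
        calc ‖χ a‖ ^ 2 = ‖χ (a * a)‖ := by rw [map_mul, norm_mul, sq]
          _ ≤ C * ‖a * a‖ := h1 _
          _ ≤ C * ‖a‖ ^ 2 := by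
            rw [sq]; exact mul_le_mul_of_nonneg_left (norm_mul_le _ _) (norm_nonneg _)
      refine abs_le_of_sq_le_sq' ?_ (by positivity) |>.2
      rwa [mul_pow, Real.sq_sqrt (norm_nonneg _)]
    have h5 : C ≤ √C := ContinuousLinearMap.opNorm_le_bound _ (Real.sqrt_nonneg _) h3
    nlinarith [Real.sq_sqrt (norm_nonneg (WeakDual.CharacterSpace.toCLM χ)), hC]
  exact (h1 f).trans (mul_le_of_le_one_left (norm_nonneg _) h2)

/-- The representation `μ` of `A` on `ℓ²(G × X)`: `μ(f)(δ_h ⊗ ξ) = δ_h ⊗ M_h(f) ξ`, where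
`M_h(f) ξ (χ)` is `f(h.χ) ξ(χ)` for `χ ∈ U_{h⁻¹}` and `0` otherwise. -/
def mu (f : A) : α.H →L[ℂ] α.H :=
  mulOp ⟨α.weight f, memℓp_infty ⟨‖f‖, by
    rintro _ ⟨x, rfl⟩
    simp only [weight]
    split_ifs
    · exact norm_character_le _ _
    · simp⟩⟩

/-- The unitary `λ_g ⊗ I` on `ℓ²(G × X)`. -/
def lam (g : G) : α.H →L[ℂ] α.H :=
  shift (fun x => (g * x.1, x.2)) (fun _ _ h => by
    simp only [Prod.mk.injEq, mul_right_inj] at h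
    exact Prod.ext h.1 h.2)

/-- The orthogonal projection `E_g` onto the closed linear span of `μ(D_{g⁻¹}) ℓ²(G × X)`. -/
def E (g : G) : α.H →L[ℂ] α.H :=
  (Submodule.span ℂ {η : α.H | ∃ f ∈ α.ideal g⁻¹, ∃ ξ : α.H, η = α.mu f ξ}
    ).topologicalClosure.starProjection

/-- The canonical partial isometry `u_g = (λ_g ⊗ I) E_g`. -/
def u (g : G) : α.H →L[ℂ] α.H := α.lam g * α.E g

/-- The reduced crossed product `A ⋊_r G` of a commutative C*-algebra `A` by a partial action:
the C*-algebra of operators on `ℓ²(G × X)` generated by the operators `μ(f) u_g` for `g ∈ G` and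
`f ∈ D_g`. It is the closure of the image of the *-algebra of the sums `∑ f_g δ_g` with
`f_g ∈ D_g` under the *-representation `∑ f_g δ_g ↦ ∑ μ(f_g) u_g`. -/
def reducedCrossedProduct : NonUnitalStarSubalgebra ℂ (α.H →L[ℂ] α.H) :=
  (NonUnitalStarAlgebra.adjoin ℂ
    {T : α.H →L[ℂ] α.H | ∃ g, ∃ f ∈ α.ideal g, T = α.mu f * α.u g}).topologicalClosure

/-- The element `f u_g` of `A ⋊_r G`, where `f ∈ D_g`. -/
def monomial (g : G) (f : α.ideal g) : α.reducedCrossedProduct :=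
  ⟨α.mu f * α.u g, NonUnitalStarSubalgebra.le_topologicalClosure _
    (NonUnitalStarAlgebra.subset_adjoin ℂ _ ⟨g, f, f.2, rfl⟩)⟩

end PartialAction

/-! ### The reduced C*-algebra of a subsemigroup of a group -/

section Semigroup

variable {G : Type*} [Group G] (P : Subsemigroup G)

/-- The isometry `V_p : δ_x ↦ δ_{px}` on `ℓ²(P)`. -/
def V (p : P) : L2 P →L[ℂ] L2 P :=
  shift (fun x : P => p * x) (fun x y h =>
    Subtype.ext (mul_left_cancel (a := (p : G)) (congrArg Subtype.val h)))

/-- The reduced semigroup C*-algebra `C*_λ(P)`, generated by the isometries `V_p`. It is unital,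
because `V_p* V_p = 1` (and `ℓ²(P) = 0` if `P` is empty). -/
def reducedCStar : StarSubalgebra ℂ (L2 P →L[ℂ] L2 P) :=
  (StarAlgebra.adjoin ℂ (Set.range (V P))).topologicalClosure

/-- The canonical commutative subalgebra `D_λ(P) = C*_λ(P) ∩ ℓ^∞(P)`. -/
def diagonal : StarSubalgebra ℂ (L2 P →L[ℂ] L2 P) := reducedCStar P ⊓ ellInfty P

/-- `HasDegree P S g` means that `S` is a product `V_{p₁}* V_{q₁} ⋯ V_{pₙ}* V_{qₙ}` (`n ≥ 1`) with
`p₁⁻¹ q₁ ⋯ pₙ⁻¹ qₙ = g`. So the `S` with `HasDegree P S g` for some `g` form the inverse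
semigroup `I_V` generated by the `V_p`, and `σ(S) = g` for `S ≠ 0`; then `g` is determined by `S`,
see `HasDegree.unique`. -/
inductive HasDegree : (L2 P →L[ℂ] L2 P) → G → Prop
  | base (p q : P) : HasDegree (star (V P p) * V P q) ((p : G)⁻¹ * q)
  | mul {S T : L2 P →L[ℂ] L2 P} {g h : G} :
      HasDegree S g → HasDegree T h → HasDegree (S * T) (g * h)

/-- The closed linear span `D_g` of the operators `S* S`, where `S ∈ I_V`, `S ≠ 0` and
`σ(S) = g⁻¹`. -/
def idealSpace (g : G) : Submodule ℂ (L2 P →L[ℂ] L2 P) :=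
  (Submodule.span ℂ {T | ∃ S, HasDegree P S g⁻¹ ∧ S ≠ 0 ∧ T = star S * S}).topologicalClosure

/-- The inclusion of `ℓ²(P)` into `ℓ²(G)`. -/
def incl : L2 P →L[ℂ] L2 G := shift (fun x : P => (x : G)) Subtype.val_injective

/-- The compression to `ℓ²(P)` of the unitary `λ_g : δ_x ↦ δ_{gx}` of `ℓ²(G)`. -/
def compr (g : G) : L2 P →L[ℂ] L2 P :=
  (ContinuousLinearMap.adjoint (incl P)).comp
    ((shift (fun x : G => g * x) (mul_right_injective g)).comp (incl P))

/-- Conjugation with `λ_g`, for operators on `ℓ²(P) ⊆ ℓ²(G)`. -/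
def conj (g : G) (d : L2 P →L[ℂ] L2 P) : L2 P →L[ℂ] L2 P :=
  compr P g * d * star (compr P g)

variable {P}

theorem mul_app {ι : Type*} (S T : L2 ι →L[ℂ] L2 ι) (ξ : L2 ι) : (S * T) ξ = S (T ξ) := rfl

theorem star_shift_delta_of_eq {ι κ : Type*} (f : ι → κ) (hf : Function.Injective f) {i : ι}
    {k : κ} (h : f i = k) : ContinuousLinearMap.adjoint (shift f hf) (delta k) = delta i := by
  ext j
  rw [adjoint_delta_apply, shift_delta]
  by_cases hj : j = i
  · subst hj; subst h; simp [delta_self]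
  · rw [delta_ne hj, delta_ne (fun h' => hj (hf (h.trans h').symm))]; simp

theorem star_shift_delta_of_ne {ι κ : Type*} (f : ι → κ) (hf : Function.Injective f)
    {k : κ} (h : ∀ i, f i ≠ k) : ContinuousLinearMap.adjoint (shift f hf) (delta k) = 0 := by
  ext j
  rw [adjoint_delta_apply, shift_delta, delta_ne (h j).symm]; simp

theorem compr_delta (g : G) (x y : P) (h : (y : G) = g * x) :
    compr P g (delta x) = delta y := by
  simp only [compr, incl, ContinuousLinearMap.comp_apply, shift_delta]
  exact star_shift_delta_of_eq _ _ h

theorem compr_delta_of_ne (g : G) (x : P) (h : ∀ y : P, (y : G) ≠ g * x) :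
    compr P g (delta x) = 0 := by
  simp only [compr, incl, ContinuousLinearMap.comp_apply, shift_delta]
  exact star_shift_delta_of_ne _ _ h

theorem compr_one : compr P (1 : G) = 1 :=
  ext_delta fun x => by rw [compr_delta 1 x x (by simp)]; rfl

theorem star_compr (g : G) : star (compr P g) = compr P g⁻¹ := by
  refine ext_delta fun x => ?_
  ext y
  rw [ContinuousLinearMap.star_eq_adjoint, adjoint_delta_apply]
  by_cases h : (x : G) = g * y
  · rw [compr_delta g y x h, compr_delta g⁻¹ x y (by simp [h]), delta_self, delta_self]; simp
  · have h1 : (compr P g (delta y)) x = 0 := by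
      by_cases h2 : ∃ z : P, (z : G) = g * y
      · obtain ⟨z, hz⟩ := h2
        rw [compr_delta g y z hz, delta_ne]
        rintro rfl; exact h hz
      · push Not at h2
        rw [compr_delta_of_ne g y h2]; simp
    have h3 : (compr P g⁻¹ (delta x)) y = 0 := by
      by_cases h2 : ∃ z : P, (z : G) = g⁻¹ * x
      · obtain ⟨z, hz⟩ := h2
        rw [compr_delta g⁻¹ x z hz, delta_ne]
        rintro rfl; exact h (by simp [hz])
      · push Not at h2
        rw [compr_delta_of_ne g⁻¹ x h2]; simp
    rw [h1, h3]; simp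

theorem V_delta (p x : P) : V P p (delta x) = delta (p * x) := shift_delta _ _ x

theorem star_V_delta_of_eq {p x y : P} (h : p * x = y) : star (V P p) (delta y) = delta x :=
  star_shift_delta_of_eq (fun x : P => p * x) _ h

theorem star_V_delta_of_ne {p y : P} (h : ∀ x, p * x ≠ y) : star (V P p) (delta y) = 0 :=
  star_shift_delta_of_ne (fun x : P => p * x) _ h

theorem HasDegree.apply_delta {S : L2 P →L[ℂ] L2 P} {g : G} (h : HasDegree P S g) :
    ∀ x : P, S (delta x) = 0 ∨ ∃ y : P, (y : G) = g * x ∧ S (delta x) = delta y := by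
  induction h with
  | base p q =>
    intro x
    rw [mul_app, V_delta]
    by_cases h : ∃ y : P, p * y = q * x
    · obtain ⟨y, hy⟩ := h
      refine Or.inr ⟨y, ?_, star_V_delta_of_eq hy⟩
      have := congrArg Subtype.val hy
      change (p : G) * y = q * x at this
      rw [mul_assoc, ← this, inv_mul_cancel_left]
    · push Not at h
      exact Or.inl (star_V_delta_of_ne h)
  | mul _ _ hS hT =>
    intro x
    simp only [mul_app]
    rcases hT x with h0 | ⟨y, hy, hTy⟩
    · exact Or.inl (by rw [h0, map_zero])
    · rw [hTy]
      rcases hS y with h0 | ⟨z, hz, hSz⟩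
      · exact Or.inl h0
      · exact Or.inr ⟨z, by rw [hz, hy, mul_assoc], hSz⟩

theorem delta_injective {ι : Type*} {i j : ι} (h : (delta i : L2 ι) = delta j) : i = j := by
  by_contra hne
  have := delta_self i
  rw [h, delta_ne hne] at this
  exact zero_ne_one this

/-- The degree map `σ` is well defined. -/
theorem HasDegree.unique {S : L2 P →L[ℂ] L2 P} {g h : G} (hg : HasDegree P S g)
    (hh : HasDegree P S h) (hS : S ≠ 0) : g = h := by
  by_contra hne
  refine hS (ext_delta fun x => ?_)
  rcases hg.apply_delta x with h0 | ⟨y, hy, hSy⟩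
  · simpa using h0
  rcases hh.apply_delta x with h0 | ⟨z, hz, hSz⟩
  · simpa using h0
  · rw [hSy] at hSz
    rw [delta_injective hSz, hz] at hy
    exact absurd (mul_right_cancel hy).symm hne

theorem HasDegree.star {S : L2 P →L[ℂ] L2 P} {g : G} (h : HasDegree P S g) :
    HasDegree P (star S) g⁻¹ := by
  induction h with
  | base p q =>
    have := HasDegree.base (P := P) q p
    simpa using this
  | mul _ _ hS hT => simpa using hT.mul hS

theorem V_mem (p : P) : V P p ∈ reducedCStar P :=
  StarSubalgebra.le_topologicalClosure _ (StarAlgebra.subset_adjoin ℂ _ ⟨p, rfl⟩)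

theorem HasDegree.mem {S : L2 P →L[ℂ] L2 P} {g : G} (h : HasDegree P S g) :
    S ∈ reducedCStar P := by
  induction h with
  | base p q => exact mul_mem (star_mem (V_mem p)) (V_mem q)
  | mul _ _ hS hT => exact mul_mem hS hT

theorem hasDegree_V (p : P) : HasDegree P (V P p) (p : G) := by
  have h := HasDegree.base (P := P) p (p * p)
  have h1 : Star.star (V P p) * V P (p * p) = V P p := by
    refine ext_delta fun x => ?_
    rw [mul_app, V_delta, V_delta]
    exact star_V_delta_of_eq (mul_assoc p p x).symm
  rw [h1] at h
  simpa using h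

theorem star_V_mul_V (p : P) : star (V P p) * V P p = 1 := by
  refine ext_delta fun x => ?_
  rw [mul_app, V_delta]
  exact star_V_delta_of_eq rfl

theorem HasDegree.star_mul_delta {S : L2 P →L[ℂ] L2 P} {g : G} (h : HasDegree P S g) (x : P) :
    (S (delta x) = 0 ∧ (Star.star S * S) (delta x) = 0) ∨
    ∃ y : P, (y : G) = g * x ∧ S (delta x) = delta y ∧ (Star.star S * S) (delta x) = delta x := by
  simp only [mul_app]
  rcases h.apply_delta x with h0 | ⟨y, hy, hSy⟩
  · exact Or.inl ⟨h0, by rw [h0, map_zero]⟩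
  · refine Or.inr ⟨y, hy, hSy, ?_⟩
    rw [hSy]
    rcases h.star.apply_delta y with h1 | ⟨z, hz, hSz⟩
    · exfalso
      have h2 := adjoint_delta_apply S x y
      rw [← ContinuousLinearMap.star_eq_adjoint, h1, hSy, delta_self] at h2
      simp at h2
    · have : z = x := Subtype.ext (by rw [hz, hy, inv_mul_cancel_left])
      rw [hSz, this]

theorem HasDegree.compr_mul {S : L2 P →L[ℂ] L2 P} {g : G} (h : HasDegree P S g) :
    compr P g * (Star.star S * S) = S := by
  refine ext_delta fun x => ?_
  rw [mul_app]
  rcases h.star_mul_delta x with ⟨h0, h1⟩ | ⟨y, hy, h0, h1⟩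
  · rw [h1, h0, map_zero]
  · rw [h1, h0, compr_delta g x y hy]

theorem HasDegree.mul_star_mul {S : L2 P →L[ℂ] L2 P} {g : G} (h : HasDegree P S g) :
    S * (Star.star S * S) = S := by
  refine ext_delta fun x => ?_
  rw [mul_app]
  rcases h.star_mul_delta x with ⟨h0, h1⟩ | ⟨y, hy, h0, h1⟩
  · rw [h1, h0, map_zero]
  · rw [h1, h0]

theorem HasDegree.mem_ellInfty {S : L2 P →L[ℂ] L2 P} (h : HasDegree P S 1) :
    S ∈ ellInfty P := by
  refine ⟨diagEntries S, ext_delta fun x => ?_⟩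
  rw [mulOp_delta, diagEntries_apply]
  rcases h.apply_delta x with h0 | ⟨y, hy, h0⟩
  · rw [h0]; simp
  · rw [one_mul] at hy
    rw [h0, Subtype.ext hy, delta_self, one_smul]

theorem HasDegree.expect_eq_zero {S : L2 P →L[ℂ] L2 P} {g : G} (h : HasDegree P S g)
    (hg : g ≠ 1) : expect P S = 0 := by
  refine ext_delta fun x => ?_
  rw [expect_apply, mulOp_delta, diagEntries_apply]
  rcases h.apply_delta x with h0 | ⟨y, hy, h0⟩
  · rw [h0]; simp
  · rw [h0, delta_ne]
    · simp
    · rintro rfl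
      exact hg (by simpa using hy)

theorem HasDegree.mem_diagonal {S : L2 P →L[ℂ] L2 P} (h : HasDegree P S 1) :
    S ∈ diagonal P := ⟨h.mem, h.mem_ellInfty⟩

theorem HasDegree.star_mul_self {S : L2 P →L[ℂ] L2 P} {g : G} (h : HasDegree P S g) :
    HasDegree P (Star.star S * S) 1 := by
  simpa using h.star.mul h

theorem HasDegree.star_mul_self_eq {S : L2 P →L[ℂ] L2 P} (h : HasDegree P S 1) :
    Star.star S * S = S := by
  simpa [compr_one] using h.compr_mul

theorem isClosed_reducedCStar : IsClosed (reducedCStar P : Set (L2 P →L[ℂ] L2 P)) :=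
  StarSubalgebra.isClosed_topologicalClosure _

instance isClosed_diagonal : IsClosed (diagonal P : Set (L2 P →L[ℂ] L2 P)) :=
  isClosed_reducedCStar.inter (isClosed_ellInfty P)

theorem diagonal_comm {S T : L2 P →L[ℂ] L2 P} (hS : S ∈ diagonal P) (hT : T ∈ diagonal P) :
    S * T = T * S := ellInfty_comm hS.2 hT.2

variable (P) in
/-- The C*-algebra `D_λ(P)`, as a type. -/
def DAlg : Type _ := diagonal P

instance : CommCStarAlgebra (DAlg P) :=
  { (inferInstance : CStarAlgebra (diagonal P)) with
    mul_comm := fun x y => Subtype.ext (diagonal_comm x.2 y.2) }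

/-- The inclusion of `D_λ(P)` into the bounded operators on `ℓ²(P)`. -/
def DAlg.val : DAlg P →⋆ₐ[ℂ] (L2 P →L[ℂ] L2 P) := (diagonal P).subtype

/-- An operator in `D_λ(P)`, as an element of the type `DAlg P`. -/
def DAlg.mk (T : L2 P →L[ℂ] L2 P) (hT : T ∈ diagonal P) : DAlg P := (⟨T, hT⟩ : diagonal P)

theorem DAlg.val_mk (T : L2 P →L[ℂ] L2 P) (hT : T ∈ diagonal P) : (DAlg.mk T hT).val = T := rfl

theorem DAlg.val_mem (d : DAlg P) : d.val ∈ diagonal P := Subtype.property (p := (· ∈ diagonal P)) d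

theorem DAlg.ext {d d' : DAlg P} (h : d.val = d'.val) : d = d' := Subtype.ext h

theorem DAlg.continuous_val : Continuous (DAlg.val : DAlg P → L2 P →L[ℂ] L2 P) :=
  continuous_subtype_val (p := (· ∈ diagonal P))

theorem adjoin_le_span [Nonempty P] {T : L2 P →L[ℂ] L2 P}
    (hT : T ∈ StarAlgebra.adjoin ℂ (Set.range (V P))) :
    T ∈ Submodule.span ℂ {S | ∃ g, HasDegree P S g} := by
  induction hT using StarAlgebra.adjoin_induction with
  | mem x hx =>
    obtain ⟨p, rfl⟩ := hx
    exact Submodule.subset_span ⟨p, hasDegree_V p⟩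
  | algebraMap r =>
    rw [Algebra.algebraMap_eq_smul_one]
    obtain ⟨p⟩ := ‹Nonempty P›
    refine Submodule.smul_mem _ _ (Submodule.subset_span ⟨(p : G)⁻¹ * p, ?_⟩)
    rw [← star_V_mul_V p]
    exact HasDegree.base p p
  | add x y _ _ hx hy => exact add_mem hx hy
  | mul x y hx₀ hy₀ hx hy =>
    clear hx₀ hy₀
    induction hx using Submodule.span_induction with
    | zero => simp
    | add a b _ _ ha hb => rw [add_mul]; exact add_mem ha hb
    | smul c a _ ha => rw [smul_mul_assoc]; exact Submodule.smul_mem _ _ ha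
    | mem a ha =>
      obtain ⟨g, ha⟩ := ha
      induction hy using Submodule.span_induction with
      | zero => simp
      | add c d _ _ hc hd => rw [mul_add]; exact add_mem hc hd
      | smul c d _ hd => rw [mul_smul_comm]; exact Submodule.smul_mem _ _ hd
      | mem b hb =>
        obtain ⟨h, hb⟩ := hb
        exact Submodule.subset_span ⟨_, ha.mul hb⟩
  | star x hx₀ hx =>
    clear hx₀
    induction hx using Submodule.span_induction with
    | zero => simp
    | add a b _ _ ha hb => rw [star_add]; exact add_mem ha hb
    | smul c a _ ha => rw [star_smul]; exact Submodule.smul_mem _ _ ha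
    | mem a ha =>
      obtain ⟨g, ha⟩ := ha
      exact Submodule.subset_span ⟨_, ha.star⟩

/-- The algebra `D_λ(P)` is the closed linear span of `σ⁻¹(1)`. -/
theorem diagonal_le_closure_span {T : L2 P →L[ℂ] L2 P} (hT : T ∈ diagonal P) :
    T ∈ (Submodule.span ℂ {S | HasDegree P S 1}).topologicalClosure := by
  rcases isEmpty_or_nonempty P with hP | hP
  · have : T = 0 := ext_delta fun x => hP.elim x
    rw [this]; exact zero_mem _
  · rw [← expect_of_mem hT.2]
    refine map_mem_closure (expect P).continuous hT.1 fun S hS => ?_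
    have hS' := adjoin_le_span hS
    clear hS
    change expect P S ∈ Submodule.span ℂ _
    induction hS' using Submodule.span_induction with
    | zero => simp
    | add a b _ _ ha hb => rw [map_add]; exact add_mem ha hb
    | smul c a _ ha => rw [map_smul]; exact Submodule.smul_mem _ _ ha
    | mem a ha =>
      obtain ⟨g, ha⟩ := ha
      by_cases hg : g = 1
      · subst hg
        rw [expect_of_mem ha.mem_ellInfty]
        exact Submodule.subset_span ha
      · rw [ha.expect_eq_zero hg]; exact zero_mem _

/-- A closed subspace containing the image of the generators contains the image of `D_g`. -/
theorem idealSpace_induction {g : G} (L : (L2 P →L[ℂ] L2 P) →L[ℂ] (L2 P →L[ℂ] L2 P))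
    (K : Submodule ℂ (L2 P →L[ℂ] L2 P)) (hK : IsClosed (K : Set (L2 P →L[ℂ] L2 P)))
    (h : ∀ S, HasDegree P S g⁻¹ → S ≠ 0 → L (star S * S) ∈ K)
    {x : L2 P →L[ℂ] L2 P} (hx : x ∈ idealSpace P g) : L x ∈ K := by
  have : idealSpace P g ≤ K.comap L.toLinearMap := by
    refine Submodule.topologicalClosure_minimal _ ?_ (hK.preimage L.continuous)
    rw [Submodule.span_le]
    rintro _ ⟨S, hS, hne, rfl⟩
    exact h S hS hne
  exact this hx

theorem isClosed_idealSpace (g : G) : IsClosed (idealSpace P g : Set (L2 P →L[ℂ] L2 P)) :=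
  Submodule.isClosed_topologicalClosure _

theorem HasDegree.mem_idealSpace {S : L2 P →L[ℂ] L2 P} {g : G} (h : HasDegree P S g⁻¹) :
    Star.star S * S ∈ idealSpace P g := by
  by_cases hS : S = 0
  · subst hS; simp
  · exact Submodule.le_topologicalClosure _ (Submodule.subset_span ⟨S, h, hS, rfl⟩)

theorem idealSpace_le {g : G} {x : L2 P →L[ℂ] L2 P} (hx : x ∈ idealSpace P g) :
    x ∈ diagonal P :=
  idealSpace_induction (ContinuousLinearMap.id ℂ _)
    (Subalgebra.toSubmodule (diagonal P).toSubalgebra) isClosed_diagonal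
    (fun _ hS _ => hS.star_mul_self.mem_diagonal) hx

theorem star_mem_idealSpace {g : G} {x : L2 P →L[ℂ] L2 P} (hx : x ∈ idealSpace P g) :
    star x ∈ idealSpace P g := by
  refine map_mem_closure continuous_star hx fun y hy => ?_
  change y ∈ Submodule.span ℂ _ at hy
  change star y ∈ Submodule.span ℂ _
  induction hy using Submodule.span_induction with
  | zero => simp
  | add a b _ _ ha hb => rw [star_add]; exact add_mem ha hb
  | smul c a _ ha => rw [star_smul]; exact Submodule.smul_mem _ _ ha
  | mem a ha =>
    obtain ⟨S, hS, hne, rfl⟩ := ha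
    exact Submodule.subset_span ⟨S, hS, hne, by simp⟩

theorem mul_mem_idealSpace {g : G} {d x : L2 P →L[ℂ] L2 P} (hd : d ∈ diagonal P)
    (hx : x ∈ idealSpace P g) : d * x ∈ idealSpace P g := by
  refine idealSpace_induction (ContinuousLinearMap.mul ℂ _ d) _ (isClosed_idealSpace g)
    (fun S hS _ => ?_) hx
  have hle : (Submodule.span ℂ {W | HasDegree P W 1}).topologicalClosure ≤
      (idealSpace P g).comap
        ((ContinuousLinearMap.mul ℂ (L2 P →L[ℂ] L2 P)).flip (star S * S)).toLinearMap := by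
    refine Submodule.topologicalClosure_minimal _ ?_
      ((isClosed_idealSpace g).preimage (ContinuousLinearMap.continuous _))
    rw [Submodule.span_le]
    intro W hW
    change W * (star S * S) ∈ idealSpace P g
    have hW' : HasDegree P W 1 := hW
    have h1 : W * (star S * S) = star (S * W) * (S * W) := by
      have hc := diagonal_comm hW'.mem_diagonal hS.star_mul_self.mem_diagonal
      calc W * (star S * S) = star W * (W * (star S * S)) := by
            rw [← mul_assoc (star W), hW'.star_mul_self_eq]
        _ = star (S * W) * (S * W) := by rw [hc, star_mul]; simp only [mul_assoc]
    rw [h1]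
    refine HasDegree.mem_idealSpace ?_
    simpa using hS.mul hW'
  exact hle (diagonal_le_closure_span hd)

theorem compr_mul_compr (g : G) {h : G} {d : L2 P →L[ℂ] L2 P} (hd : d ∈ idealSpace P h⁻¹) :
    compr P g * (compr P h * d) = compr P (g * h) * d := by
  have := idealSpace_induction (ContinuousLinearMap.mul ℂ _ (compr P g * compr P h)
    - ContinuousLinearMap.mul ℂ _ (compr P (g * h))) ⊥ (isClosed_singleton)
    (fun S hS _ => ?_) hd
  · rw [← mul_assoc]
    exact sub_eq_zero.1 ((Submodule.mem_bot ℂ).1 this)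
  · rw [inv_inv] at hS
    rw [Submodule.mem_bot]
    refine sub_eq_zero.2 (ext_delta fun x => ?_)
    change (compr P g * compr P h * (star S * S)) (delta x) =
      (compr P (g * h) * (star S * S)) (delta x)
    rw [mul_app (compr P g * compr P h), mul_app (compr P (g * h)), mul_app]
    rcases hS.star_mul_delta x with ⟨h0, h1⟩ | ⟨y, hy, h0, h1⟩
    · rw [h1]; simp
    · rw [h1, compr_delta h x y hy]
      by_cases hz : ∃ z : P, (z : G) = g * y
      · obtain ⟨z, hz⟩ := hz
        rw [compr_delta g y z hz, compr_delta (g * h) x z (by rw [hz, hy, mul_assoc])]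
      · push Not at hz
        rw [compr_delta_of_ne g y hz, compr_delta_of_ne]
        intro z
        have := hz z
        rwa [hy, ← mul_assoc] at this

theorem conj_conj (g : G) {h : G} {d : L2 P →L[ℂ] L2 P} (hd : d ∈ idealSpace P h⁻¹) :
    conj P g (conj P h d) = conj P (g * h) d := by
  have h1 := compr_mul_compr g hd
  have h2 := congrArg star (compr_mul_compr g (star_mem_idealSpace hd))
  simp only [star_mul, star_star] at h2
  calc conj P g (conj P h d)
      = (compr P g * (compr P h * d)) * (star (compr P h) * star (compr P g)) := by
        simp only [conj, mul_assoc]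
    _ = compr P (g * h) * (d * star (compr P h) * star (compr P g)) := by
        rw [h1]; simp only [mul_assoc]
    _ = conj P (g * h) d := by rw [h2, conj, mul_assoc]

theorem conj_one (d : L2 P →L[ℂ] L2 P) : conj P 1 d = d := by simp [conj, compr_one]

theorem conj_mul {g : G} {d d' : L2 P →L[ℂ] L2 P} (hd' : d' ∈ idealSpace P g⁻¹) :
    conj P g (d * d') = conj P g d * conj P g d' := by
  have h1 := compr_mul_compr g⁻¹ hd'
  rw [inv_mul_cancel, compr_one, one_mul, ← star_compr] at h1
  calc conj P g (d * d') = compr P g * d * d' * star (compr P g) := by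
        simp only [conj, mul_assoc]
    _ = compr P g * d * (star (compr P g) * (compr P g * d')) * star (compr P g) := by rw [h1]
    _ = _ := by simp only [conj, mul_assoc]

theorem HasDegree.conj_eq {S : L2 P →L[ℂ] L2 P} {g : G} (h : HasDegree P S g) :
    conj P g (Star.star S * S) = S * Star.star S := by
  have h2 := congrArg Star.star h.compr_mul
  simp only [star_mul, star_star] at h2
  rw [conj, h.compr_mul]
  nth_rw 1 [← h.mul_star_mul]
  rw [mul_assoc, h2]

/-- Conjugation with `λ_g` as a continuous linear map. -/
def conjL (g : G) : (L2 P →L[ℂ] L2 P) →L[ℂ] (L2 P →L[ℂ] L2 P) :=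
  ((ContinuousLinearMap.mul ℂ (L2 P →L[ℂ] L2 P)).flip (star (compr P g))).comp
    (ContinuousLinearMap.mul ℂ _ (compr P g))

theorem conjL_apply (g : G) (d : L2 P →L[ℂ] L2 P) : conjL g d = conj P g d := rfl

theorem conj_mem {g : G} {d : L2 P →L[ℂ] L2 P} (hd : d ∈ idealSpace P g⁻¹) :
    conj P g d ∈ idealSpace P g := by
  rw [← conjL_apply]
  refine idealSpace_induction (conjL g) _ (isClosed_idealSpace g) (fun S hS _ => ?_) hd
  rw [inv_inv] at hS
  rw [conjL_apply, hS.conj_eq]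
  simpa using hS.star.mem_idealSpace

variable (P)

/-- The ideal `D_g` of `D_λ(P)`. -/
def ideal (g : G) : NonUnitalStarSubalgebra ℂ (DAlg P) where
  carrier := {d | d.val ∈ idealSpace P g}
  add_mem' := fun {a b} ha hb => by
    change (a + b).val ∈ idealSpace P g
    rw [map_add]; exact Submodule.add_mem _ ha hb
  zero_mem' := by
    change (0 : DAlg P).val ∈ idealSpace P g
    rw [map_zero]; exact zero_mem _
  smul_mem' := fun c x hx => by
    change (c • x).val ∈ idealSpace P g
    rw [map_smul]; exact Submodule.smul_mem _ c hx
  mul_mem' := fun {a b} _ hb => by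
    change (a * b).val ∈ idealSpace P g
    rw [map_mul]; exact mul_mem_idealSpace a.val_mem hb
  star_mem' := fun {a} ha => by
    change (star a).val ∈ idealSpace P g
    rw [map_star]; exact star_mem_idealSpace ha

variable {P}

theorem mem_ideal {g : G} {d : DAlg P} : d ∈ ideal P g ↔ d.val ∈ idealSpace P g := Iff.rfl

theorem isClosed_ideal (g : G) : IsClosed (ideal P g : Set (DAlg P)) :=
  (isClosed_idealSpace g).preimage DAlg.continuous_val

theorem ideal_ext {g : G} {d d' : ideal P g} (h : (d : DAlg P).val = (d' : DAlg P).val) :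
    d = d' := Subtype.ext (DAlg.ext h)

theorem mem_inv_inv {g : G} (d : ideal P g) : (d : DAlg P).val ∈ idealSpace P g⁻¹⁻¹ := by
  rw [inv_inv]; exact mem_ideal.1 d.2

/-- The map `D_{g⁻¹} → D_g` given by conjugation with `λ_g`. -/
def actFun (g k : G) (hk : k = g⁻¹) (d : ideal P k) : ideal P g :=
  ⟨DAlg.mk (conj P g (d : DAlg P).val) (idealSpace_le (conj_mem (hk ▸ mem_ideal.1 d.2))),
    conj_mem (hk ▸ mem_ideal.1 d.2)⟩

theorem actFun_val (g k : G) (hk : k = g⁻¹) (d : ideal P k) :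
    (actFun g k hk d : DAlg P).val = conj P g (d : DAlg P).val := rfl

variable (P)

/-- The *-isomorphism `α*_g : D_{g⁻¹} → D_g`, given by conjugation with `λ_g`. -/
def actEquiv (g : G) : ideal P g⁻¹ ≃⋆ₐ[ℂ] ideal P g where
  toFun := actFun g g⁻¹ rfl
  invFun := actFun g⁻¹ g (inv_inv g).symm
  left_inv d := ideal_ext (by
    rw [actFun_val, actFun_val, conj_conj _ (mem_ideal.1 d.2), inv_mul_cancel, conj_one])
  right_inv d := ideal_ext (by
    rw [actFun_val, actFun_val, conj_conj _ (mem_inv_inv d), mul_inv_cancel, conj_one])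
  map_mul' d d' := ideal_ext (by
    rw [actFun_val, NonUnitalStarSubalgebra.coe_mul, NonUnitalStarSubalgebra.coe_mul, map_mul,
      map_mul, actFun_val, actFun_val, conj_mul (mem_ideal.1 d'.2)])
  map_add' d d' := ideal_ext (by
    rw [actFun_val, NonUnitalStarSubalgebra.coe_add, NonUnitalStarSubalgebra.coe_add, map_add,
      map_add, actFun_val, actFun_val, ← conjL_apply, map_add]; rfl)
  map_smul' c d := ideal_ext (by
    rw [actFun_val, NonUnitalStarSubalgebra.coe_smul, NonUnitalStarSubalgebra.coe_smul, map_smul,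
      map_smul, actFun_val, ← conjL_apply, map_smul]; rfl)
  map_star' d := ideal_ext (by
    have h1 : ((star d : ideal P g⁻¹) : DAlg P) = star (d : DAlg P) := rfl
    have h2 : ∀ e : ideal P g, ((star e : ideal P g) : DAlg P) = star (e : DAlg P) :=
      fun _ => rfl
    rw [actFun_val, h1, h2, map_star, map_star, actFun_val]
    simp only [conj, star_mul, star_star, mul_assoc])

theorem actEquiv_val (g : G) (d : ideal P g⁻¹) :
    (actEquiv P g d : DAlg P).val = conj P g (d : DAlg P).val := rfl

/-- The isomorphism `α*_g` maps `S* S` to `S S*` whenever `S ∈ I_V` and `σ(S) = g`. -/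
theorem actEquiv_star_mul_self {g : G} {S : L2 P →L[ℂ] L2 P} (h : HasDegree P S g)
    (d : ideal P g⁻¹) (hd : (d : DAlg P).val = star S * S) :
    (actEquiv P g d : DAlg P).val = S * star S := by
  rw [actEquiv_val, hd, h.conj_eq]

variable {P}

theorem mem_of_inter {g h : G} {y : L2 P →L[ℂ] L2 P} (hy : y ∈ idealSpace P h)
    (hy' : y ∈ idealSpace P g⁻¹) : conj P h⁻¹ y ∈ idealSpace P (g * h)⁻¹ := by
  -- products of elements of the two ideals
  have key : ∀ p ∈ idealSpace P h, ∀ q ∈ idealSpace P g⁻¹,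
      conj P h⁻¹ (p * q) ∈ idealSpace P (g * h)⁻¹ := by
    intro p hp q hq
    refine idealSpace_induction ((conjL h⁻¹).comp (ContinuousLinearMap.mul ℂ _ p)) _
      (isClosed_idealSpace _) (fun W hW _ => ?_) hq
    refine idealSpace_induction ((conjL h⁻¹).comp
      ((ContinuousLinearMap.mul ℂ (L2 P →L[ℂ] L2 P)).flip (star W * W))) _
      (isClosed_idealSpace _) (fun R hR _ => ?_) hp
    rw [inv_inv] at hW
    change conj P h⁻¹ (star R * R * (star W * W)) ∈ _
    have e1 : star R * R * (star W * W) = (star R * R) * (star W * W) * (star R * R) := by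
      have hPP : star R * R * (star R * R) = star R * R := by rw [mul_assoc, hR.mul_star_mul]
      have hcomm := diagonal_comm hR.star_mul_self.mem_diagonal hW.star_mul_self.mem_diagonal
      rw [hcomm, mul_assoc (star W * W), hPP]
    have e2 : compr P h⁻¹ * (star R * R) = R := hR.compr_mul
    have e3 := congrArg star e2
    simp only [star_mul, star_star] at e3
    have e4 : conj P h⁻¹ (star R * R * (star W * W)) = star (W * star R) * (W * star R) := by
      rw [e1, conj]
      calc _ = (compr P h⁻¹ * (star R * R)) * (star W * W) *
            (star R * R * star (compr P h⁻¹)) := by simp only [mul_assoc]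
        _ = _ := by rw [e2, e3, star_mul, star_star]; simp only [mul_assoc]
    rw [e4]
    refine HasDegree.mem_idealSpace ?_
    rw [inv_inv]
    simpa using hW.mul hR.star
  have := isClosed_ideal (P := P) h
  let _ := CStarAlgebra.spectralOrder (ideal P h)
  have := CStarAlgebra.spectralOrderedRing (ideal P h)
  have hap := CStarAlgebra.increasingApproximateUnit (ideal P h)
  have := hap.neBot
  let y' : ideal P h := ⟨DAlg.mk y (idealSpace_le hy), hy⟩
  have ht := hap.tendsto_mul_right y'
  have hcont : Continuous fun e : ideal P h => conjL h⁻¹ (e : DAlg P).val :=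
    (conjL h⁻¹).continuous.comp (DAlg.continuous_val.comp continuous_subtype_val)
  refine (isClosed_idealSpace (P := P) (g * h)⁻¹).mem_of_tendsto
    ((hcont.tendsto y').comp ht) (Filter.Eventually.of_forall fun e => ?_)
  have he := key (e : DAlg P).val (mem_ideal.1 e.2) y hy'
  rw [Function.comp_apply, NonUnitalStarSubalgebra.coe_mul, map_mul]
  exact he

variable (P)

/-- The canonical partial action `α*` of `G` on `D_λ(P)`. -/
def partialAction : PartialAction G (DAlg P) where
  ideal := ideal P
  isClosed_ideal := isClosed_ideal
  mul_mem_left := fun _ a x hx => by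
    rw [mem_ideal, map_mul]; exact mul_mem_idealSpace a.val_mem (mem_ideal.1 hx)
  mul_mem_right := fun _ a x hx => by
    rw [mul_comm, mem_ideal, map_mul]; exact mul_mem_idealSpace a.val_mem (mem_ideal.1 hx)
  act := actEquiv P
  ideal_one := by
    refine top_unique fun d _ => ?_
    have hle : (Submodule.span ℂ {S | HasDegree P S 1}).topologicalClosure ≤
        idealSpace P 1 := by
      refine Submodule.topologicalClosure_minimal _ ?_ (isClosed_idealSpace 1)
      rw [Submodule.span_le]
      intro W hW
      have hW' : HasDegree P W 1 := hW
      change W ∈ idealSpace P 1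
      rw [← hW'.star_mul_self_eq]
      exact HasDegree.mem_idealSpace (by simpa using hW')
    exact mem_ideal.2 (hle (diagonal_le_closure_span d.val_mem))
  act_one := fun x => DAlg.ext (by rw [actEquiv_val, conj_one])
  act_act := fun g h x hx => by
    have h0 := mem_ideal.1 x.2
    have h1 : conj P h⁻¹ (conj P h (x : DAlg P).val) = (x : DAlg P).val := by
      rw [conj_conj _ h0, inv_mul_cancel, conj_one]
    have h2 : (x : DAlg P).val ∈ idealSpace P (g * h)⁻¹ := by
      rw [← h1]; exact mem_of_inter (conj_mem h0) (mem_ideal.1 hx)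
    refine ⟨mem_ideal.2 h2, DAlg.ext ?_⟩
    rw [actEquiv_val, actEquiv_val, actEquiv_val, conj_conj _ h0]

/-- The isometry `V_p` as an element of `C*_λ(P)`. -/
def genV (p : P) : reducedCStar P := ⟨V P p, V_mem p⟩

variable {P} in
theorem range_mem (p : P) : V P p * star (V P p) ∈ idealSpace P (p : G) := by
  have := (hasDegree_V p).star.mem_idealSpace
  rwa [star_star] at this

/-- The projection `V_p V_p*` as an element of the ideal `D_p` of `D_λ(P)`. -/
def rangeProj (p : P) : (partialAction P).ideal (p : G) :=
  ⟨DAlg.mk (V P p * star (V P p)) (idealSpace_le (range_mem p)), range_mem p⟩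

end Semigroup

end SemigroupCStar

end

/-!
Both algebras are compared with a third one. To an operator `S` in `I_V` of degree `g` there
corresponds the operator `S S* u_g` on `ℓ²(G × X)`. By covariance of the dual action
(`PartialAction.weight_act`), it is equal to `λ_g S* S` (`PartialAction.mu_act_mul_u`); in this form
it is easy to see that the correspondence is compatible with products and adjoints (`image_mul`,
`image_star`). So the C*-algebra `graph P` generated by all pairs `(S, S S* u_g)` is the closed
linear span of these pairs (`adjoin_pairs_le_span`).

Both components of a pair carry a faithful conditional expectation, which takes an operator to its
diagonal part. On a pair with `g ≠ 1` both expectations vanish; for `g = 1` the pair is `(S, μ(S))`,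
with `S` in `D_λ(P)`. Hence on the span the expectations are intertwined by `μ`, which is
isometric since it contains the Gelfand transform (`PartialAction.norm_mu`), and by continuity the
expectations of the two components of any element of `graph P` have the same norm
(`norm_expect_eq`). Applied to `c* c`, this shows that an element of `graph P` with one component
zero is zero (`snd_eq_zero`, `fst_eq_zero`). An injective *-homomorphism of C*-algebras is isometric
and has closed range, so the two projections of `graph P` are the C*-algebras generated by the
components, namely `C*_λ(P)` (`mem_reducedCStar_iff`) and the reduced crossed product
(`mem_reducedCrossedProduct_iff`), and `graph P` is the graph of a *-isomorphism between them.

For uniqueness, the elements on which two *-isomorphisms agree form a C*-algebra; if it contains the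
`V_p`, then it contains all of `I_V`, which spans a dense subspace of `C*_λ(P)`.
-/

namespace SemigroupCStar

/-! ### Graphs of *-isomorphisms -/

section Graph

/-- The algebra of bounded operators on `ℓ²(ι)`. -/
abbrev Op (ι : Type*) : Type _ := L2 ι →L[ℂ] L2 ι

variable {ι κ : Type*} {C : NonUnitalStarSubalgebra ℂ (Op ι × Op κ)}

/-- If a C*-algebra `C` of pairs of operators is the graph of a map, then the domain of this map is
closed: the first projection of `C` is an injective *-homomorphism, hence isometric. -/
theorem isClosed_map_fst (hC : IsClosed (C : Set (Op ι × Op κ)))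
    (h : ∀ c ∈ C, c.1 = 0 → c.2 = 0) :
    IsClosed (C.map (NonUnitalStarAlgHom.fst ℂ (Op ι) (Op κ)) : Set (Op ι)) := by
  let f : C →⋆ₙₐ[ℂ] Op ι :=
    (NonUnitalStarAlgHom.fst ℂ (Op ι) (Op κ)).comp (NonUnitalStarSubalgebraClass.subtype C)
  have hf : Function.Injective f := (injective_iff_map_eq_zero f).2 fun c hc =>
    Subtype.ext (Prod.ext hc (h c c.2 hc))
  have hr : (C.map (NonUnitalStarAlgHom.fst ℂ _ _) : Set _) = Set.range f := Set.ext fun a =>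
    ⟨fun ⟨c, hc, h⟩ => ⟨⟨c, hc⟩, h⟩, fun ⟨c, h⟩ => ⟨c, c.2, h⟩⟩
  rw [hr]
  exact (NonUnitalStarAlgHom.isometry f hf).isClosedEmbedding.isClosed_range

theorem isClosed_map_snd (hC : IsClosed (C : Set (Op ι × Op κ)))
    (h : ∀ c ∈ C, c.2 = 0 → c.1 = 0) :
    IsClosed (C.map (NonUnitalStarAlgHom.snd ℂ (Op ι) (Op κ)) : Set (Op κ)) := by
  let f : C →⋆ₙₐ[ℂ] Op κ :=
    (NonUnitalStarAlgHom.snd ℂ (Op ι) (Op κ)).comp (NonUnitalStarSubalgebraClass.subtype C)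
  have hf : Function.Injective f := (injective_iff_map_eq_zero f).2 fun c hc =>
    Subtype.ext (Prod.ext (h c c.2 hc) hc)
  have hr : (C.map (NonUnitalStarAlgHom.snd ℂ _ _) : Set _) = Set.range f := Set.ext fun a =>
    ⟨fun ⟨c, hc, h⟩ => ⟨⟨c, hc⟩, h⟩, fun ⟨c, h⟩ => ⟨c, c.2, h⟩⟩
  rw [hr]
  exact (NonUnitalStarAlgHom.isometry f hf).isClosedEmbedding.isClosed_range

/-- A *-algebra of pairs of operators that projects bijectively onto `S` and onto `T` is the graph
of a *-isomorphism from `S` to `T`. -/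
theorem exists_starAlgEquiv_of_graph {S : StarSubalgebra ℂ (Op ι)}
    {T : NonUnitalStarSubalgebra ℂ (Op κ)}
    (h₁ : ∀ c ∈ C, c.1 = 0 → c.2 = 0) (h₂ : ∀ c ∈ C, c.2 = 0 → c.1 = 0)
    (hS : ∀ a, a ∈ S ↔ ∃ b, (a, b) ∈ C) (hT : ∀ b, b ∈ T ↔ ∃ a, (a, b) ∈ C) :
    ∃ φ : S ≃⋆ₐ[ℂ] T, ∀ (s : S) (t : T), ((s : Op ι), (t : Op κ)) ∈ C → φ s = t := by
  let f : C →⋆ₙₐ[ℂ] S := NonUnitalStarAlgHom.codRestrict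
    ((NonUnitalStarAlgHom.fst ℂ (Op ι) (Op κ)).comp (NonUnitalStarSubalgebraClass.subtype C))
    S.toNonUnitalStarSubalgebra fun c => (hS _).2 ⟨_, c.2⟩
  let k : C →⋆ₙₐ[ℂ] T := NonUnitalStarAlgHom.codRestrict
    ((NonUnitalStarAlgHom.snd ℂ (Op ι) (Op κ)).comp (NonUnitalStarSubalgebraClass.subtype C))
    T fun c => (hT _).2 ⟨_, c.2⟩
  have hf : Function.Bijective f := by
    refine ⟨(injective_iff_map_eq_zero f).2 fun c hc => ?_, fun s => ?_⟩
    · have hc' : (c : Op ι × Op κ).1 = 0 := congrArg Subtype.val hc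
      exact Subtype.ext (Prod.ext hc' (h₁ c c.2 hc'))
    · obtain ⟨b, hb⟩ := (hS s).1 s.2
      exact ⟨⟨_, hb⟩, rfl⟩
  have hk : Function.Bijective k := by
    refine ⟨(injective_iff_map_eq_zero k).2 fun c hc => ?_, fun t => ?_⟩
    · have hc' : (c : Op ι × Op κ).2 = 0 := congrArg Subtype.val hc
      exact Subtype.ext (Prod.ext (h₂ c c.2 hc') hc')
    · obtain ⟨a, ha⟩ := (hT t).1 t.2
      exact ⟨⟨_, ha⟩, rfl⟩
  refine ⟨(StarAlgEquiv.ofBijective f hf).symm.trans (StarAlgEquiv.ofBijective k hk),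
    fun s t hst => ?_⟩
  have h : (StarAlgEquiv.ofBijective f hf).symm s = ⟨_, hst⟩ :=
    (StarAlgEquiv.ofBijective f hf).symm_apply_eq.2 rfl
  rw [StarAlgEquiv.trans_apply, h]
  rfl

/-- Two *-isomorphisms between C*-algebras agree on a C*-subalgebra. -/
theorem exists_mem_iff_apply_eq {S : StarSubalgebra ℂ (Op ι)}
    {T : NonUnitalStarSubalgebra ℂ (Op κ)} (hS : IsClosed (S : Set (Op ι)))
    (hT : IsClosed (T : Set (Op κ))) (φ ψ : S ≃⋆ₐ[ℂ] T) :
    ∃ K : NonUnitalStarSubalgebra ℂ (Op ι), IsClosed (K : Set (Op ι)) ∧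
      ∀ s : S, (s : Op ι) ∈ K ↔ φ s = ψ s := by
  have hφ : Continuous φ := (NonUnitalStarAlgHom.isometry φ φ.injective).continuous
  have hψ : Continuous ψ := (NonUnitalStarAlgHom.isometry ψ ψ.injective).continuous
  refine ⟨(NonUnitalStarAlgHom.equalizer φ ψ).map S.subtype,
    hS.isClosedEmbedding_subtypeVal.isClosedMap _ (isClosed_eq hφ hψ), fun s => ⟨?_, ?_⟩⟩
  · rintro ⟨s', hs', he⟩
    rw [← Subtype.ext he]
    exact hs'
  · intro hs
    exact ⟨s, hs, rfl⟩

end Graph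

/-! ### The expectation onto the diagonal -/

/-- The expectation onto the diagonal operators is faithful: the diagonal entries of `T* T` are
the numbers `‖T δ_i‖²`. -/
theorem eq_zero_of_expect_star_mul_self {ι : Type*} {T : L2 ι →L[ℂ] L2 ι}
    (h : expect ι (star T * T) = 0) : T = 0 := by
  refine ext_delta fun i => ?_
  have h1 := congrArg (fun S : L2 ι →L[ℂ] L2 ι => S (delta i) i) h
  simp only [expect_apply, mulOp_apply, diagEntries_apply, delta_self, mul_one] at h1
  rw [← inner_delta, mul_app, ContinuousLinearMap.star_eq_adjoint,
    ContinuousLinearMap.adjoint_inner_right] at h1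
  simpa using h1

namespace PartialAction

/-! ### The dual action and the covariance relation -/

section Covariance

variable {G A : Type*} [Group G] [NonUnitalCommCStarAlgebra A] (α : PartialAction G A)

theorem act_of_eq_one {k : G} (hk : k = 1) (x : α.ideal k⁻¹) : (α.act k x : A) = x := by
  subst hk
  exact α.act_one x

theorem act_inv_act (g : G) (x : α.ideal g⁻¹) (hx : (α.act g x : A) ∈ α.ideal g⁻¹⁻¹) :
    (α.act g⁻¹ ⟨α.act g x, hx⟩ : A) = x := by
  obtain ⟨hx', h⟩ := α.act_act g⁻¹ g x hx
  rw [← h]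
  exact α.act_of_eq_one (inv_mul_cancel g) _

/-- The dual partial action satisfies `(gh).χ = g.(h.χ)` whenever the right-hand side is
defined. -/
theorem dual_mul {g h k : G} (hk : k = g * h) {χ : WeakDual.characterSpace ℂ A}
    (hχ : χ ∈ α.U h⁻¹) (hψ : α.dual h χ hχ ∈ α.U g⁻¹) :
    ∃ hχ' : χ ∈ α.U k⁻¹, α.dual k χ hχ' = α.dual g (α.dual h χ hχ) hψ := by
  subst hk
  obtain ⟨a, ha, hne⟩ := id hψ
  obtain ⟨b, hb, hbne⟩ := id hχ
  obtain ⟨x, hx⟩ : ∃ x, α.act h x = ⟨α.act h ⟨b, hb⟩ * a, α.mul_mem_right h a _ (Subtype.prop _)⟩ :=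
    ⟨(α.act h).symm _, StarAlgEquiv.apply_symm_apply _ _⟩
  have hxa : (α.act h x : A) ∈ α.ideal g⁻¹ := by
    rw [hx]; exact α.mul_mem_left g⁻¹ _ _ ha
  have hxne : χ (x : A) ≠ 0 := by
    have h1 := α.dual_act h χ hχ x
    rw [hx, map_mul, α.dual_act h χ hχ] at h1
    rw [← h1]
    exact mul_ne_zero hbne hne
  -- `α_h⁻¹(D_h ∩ D_{g⁻¹})` contains the products `c x` for `c ∈ D_{h⁻¹}`; a general `c` has to be
  -- multiplied by `b` first
  have key : ∀ c : α.ideal h⁻¹, ∃ hc : ((c * x : α.ideal h⁻¹) : A) ∈ α.ideal (g * h)⁻¹,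
      α.dual g _ hψ (α.act (g * h) ⟨_, hc⟩) = χ ((c * x : α.ideal h⁻¹) : A) := by
    intro c
    have hm : (α.act h (c * x) : A) ∈ α.ideal g⁻¹ := by
      rw [map_mul]; exact α.mul_mem_left g⁻¹ _ _ hxa
    obtain ⟨hc, he⟩ := α.act_act g h (c * x) hm
    refine ⟨hc, ?_⟩
    rw [he, α.dual_act g _ hψ]
    exact α.dual_act h χ hχ _
  obtain ⟨hz, hze⟩ := key ⟨b, hb⟩
  have hzne : χ (b * (x : A)) ≠ 0 := by rw [map_mul]; exact mul_ne_zero hbne hxne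
  have hmem : χ ∈ α.U (g * h)⁻¹ := ⟨_, hz, hzne⟩
  refine ⟨hmem, (α.dual_unique _ χ hmem _ fun c => ?_).symm⟩
  obtain ⟨hc, hce⟩ := key ⟨c * b, α.mul_mem_left h⁻¹ _ _ hb⟩
  have e : (⟨_, hc⟩ : α.ideal (g * h)⁻¹) = c * ⟨_, hz⟩ := Subtype.ext (mul_assoc _ _ _)
  rw [e, map_mul, NonUnitalStarSubalgebra.coe_mul, map_mul, hze] at hce
  refine mul_right_cancel₀ hzne (hce.trans ?_)
  rw [← map_mul]
  exact congrArg χ (mul_assoc (c : A) b x)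

/-- Covariance of the weights: `α_g(f)(gh.χ) = f(h.χ)` for `f ∈ D_{g⁻¹}`, both sides being zero
where they are undefined. -/
theorem weight_act (g : G) (f : α.ideal g⁻¹) (h : G) (χ : WeakDual.characterSpace ℂ A) :
    α.weight (α.act g f) (g * h, χ) = α.weight f (h, χ) := by
  by_cases h0 : α.weight f (h, χ) = 0
  · rw [h0]
    by_contra hne
    simp only [weight] at hne
    split_ifs at hne with hχ
    · have hmem : (α.act g f : A) ∈ α.ideal g⁻¹⁻¹ := by rw [inv_inv]; exact Subtype.prop _
      obtain ⟨hχ', hd⟩ := α.dual_mul (g := g⁻¹) (k := h) (by simp) hχ ⟨_, hmem, hne⟩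
      simp only [weight, dif_pos hχ'] at h0
      have h1 := α.dual_act g⁻¹ _ ⟨_, hmem, hne⟩ ⟨_, hmem⟩
      rw [α.act_inv_act, ← hd, h0] at h1
      exact hne h1.symm
    · exact hne rfl
  · simp only [weight] at h0
    split_ifs at h0 with hχ
    · obtain ⟨hχ', hd⟩ := α.dual_mul rfl hχ ⟨_, f.2, h0⟩
      simp only [weight, dif_pos hχ, dif_pos hχ', hd]
      exact α.dual_act g _ _ f
    · exact absurd rfl h0

theorem weight_mul (a b : A) (x : G × WeakDual.characterSpace ℂ A) :
    α.weight (a * b) x = α.weight a x * α.weight b x := by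
  simp only [weight]
  split_ifs <;> simp

theorem mu_apply (f : A) (ξ : α.H) (x : G × WeakDual.characterSpace ℂ A) :
    α.mu f ξ x = α.weight f x * ξ x := rfl

theorem mu_delta (f : A) (x : G × WeakDual.characterSpace ℂ A) :
    α.mu f (delta x) = α.weight f x • delta x := mulOp_delta _ x

theorem lam_delta (g : G) (x : G × WeakDual.characterSpace ℂ A) :
    α.lam g (delta x) = delta (g * x.1, x.2) := shift_delta _ _ x

theorem star_lam (g : G) : star (α.lam g) = α.lam g⁻¹ := by
  refine ext_delta fun x => ?_
  rw [lam_delta]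
  exact star_shift_delta_of_eq (fun x : G × WeakDual.characterSpace ℂ A => (g * x.1, x.2)) _
    (by simp)

theorem E_delta_of_ne_zero {g : G} {f : A} (hf : f ∈ α.ideal g⁻¹)
    {x : G × WeakDual.characterSpace ℂ A} (h : α.weight f x ≠ 0) :
    α.E g (delta x) = delta x := by
  refine Submodule.starProjection_eq_self_iff.2 (Submodule.le_topologicalClosure _ ?_)
  have h1 : (delta x : α.H) = (α.weight f x)⁻¹ • α.mu f (delta x) := by
    rw [mu_delta, smul_smul, inv_mul_cancel₀ h, one_smul]
  rw [h1]
  exact Submodule.smul_mem _ _ (Submodule.subset_span ⟨f, hf, _, rfl⟩)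

theorem E_delta_of_eq_zero {g : G} {x : G × WeakDual.characterSpace ℂ A}
    (h : ∀ f ∈ α.ideal g⁻¹, α.weight f x = 0) : α.E g (delta x) = 0 := by
  refine (Submodule.starProjection_apply_eq_zero_iff _).2 ?_
  rw [Submodule.orthogonal_closure]
  refine (Submodule.mem_orthogonal' _ _).2 fun η hη => ?_
  induction hη using Submodule.span_induction with
  | zero => simp
  | add a b _ _ ha hb => rw [inner_add_right, ha, hb, add_zero]
  | smul c a _ ha => rw [inner_smul_right, ha, mul_zero]
  | mem η hη =>
    obtain ⟨f, hf, ξ, rfl⟩ := hη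
    rw [inner_delta, mu_apply, h f hf, zero_mul]

/-- The covariance relation `α_g(f) u_g = λ_g f`, for `f ∈ D_{g⁻¹}`. -/
theorem mu_act_mul_u (g : G) (f : α.ideal g⁻¹) :
    α.mu (α.act g f) * α.u g = α.lam g * α.mu f := by
  refine ext_delta fun x => ?_
  simp only [u, mul_app, mu_delta, map_smul, lam_delta]
  by_cases h : ∀ f ∈ α.ideal g⁻¹, α.weight f x = 0
  · rw [α.E_delta_of_eq_zero h, h f f.2]
    simp
  · push Not at h
    obtain ⟨f', hf', hne⟩ := h
    rw [α.E_delta_of_ne_zero hf' hne, lam_delta, mu_delta, weight_act]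

/-- The operator `λ_g f`, for a self-adjoint `f ∈ D_{g⁻¹}`, has the adjoint `λ_{g⁻¹} α_g(f)`. -/
theorem star_lam_mul_mu (g : G) (f : α.ideal g⁻¹) (hf : ∀ x, star (α.weight f x) = α.weight f x) :
    star (α.lam g * α.mu f) = α.lam g⁻¹ * α.mu (α.act g f) := by
  have h1 : star (α.mu f) = α.mu f := by
    rw [mu, mulOp_star]
    congr 1
    ext x
    exact hf x
  refine ext_delta fun x => ?_
  have h2 := α.weight_act g f (g⁻¹ * x.1) x.2
  rw [mul_inv_cancel_left] at h2
  rw [star_mul, h1, star_lam]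
  simp only [mul_app, mu_delta, map_smul, lam_delta, ← h2]

/-- `λ_g f · λ_h f' = λ_{gh} f''` if `f'' ∈ D_{h⁻¹}` and `α_h(f'') = f α_h(f')`. -/
theorem lam_mul_mu_mul (g h : G) (f : A) (f' f'' : α.ideal h⁻¹)
    (hf : (α.act h f'' : A) = f * α.act h f') :
    α.lam g * α.mu f * (α.lam h * α.mu f') = α.lam (g * h) * α.mu f'' := by
  refine ext_delta fun x => ?_
  simp only [mul_app, mu_delta, map_smul, lam_delta, smul_smul, mul_assoc]
  rw [← α.weight_act h f'' x.1 x.2, hf, weight_mul, α.weight_act h f' x.1 x.2, mul_comm]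

/-- The map `μ` as a linear map. -/
noncomputable def muL : A →ₗ[ℂ] (α.H →L[ℂ] α.H) where
  toFun := α.mu
  map_add' a b := by
    refine ext_delta fun x => ?_
    simp only [add_apply, mu_delta, ← add_smul]
    congr 1
    simp only [weight]; split_ifs <;> simp
  map_smul' c a := by
    refine ext_delta fun x => ?_
    simp only [smul_apply, mu_delta, smul_smul, RingHom.id_apply]
    congr 1
    simp only [weight]; split_ifs <;> simp

theorem norm_mu_le (f : A) : ‖α.mu f‖ ≤ ‖f‖ := by
  refine (norm_mulOp_le _).trans (lp.norm_le_of_forall_le (norm_nonneg _) fun x => ?_)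
  change ‖α.weight f x‖ ≤ _
  simp only [weight]
  split_ifs
  · exact norm_character_le _ _
  · simp

theorem continuous_mu : Continuous α.mu :=
  (α.muL.mkContinuous 1 fun f => by rw [one_mul]; exact α.norm_mu_le f).continuous

theorem mu_zero : α.mu 0 = 0 := α.muL.map_zero

theorem mu_add (a b : A) : α.mu (a + b) = α.mu a + α.mu b := α.muL.map_add a b

theorem mu_smul (c : ℂ) (a : A) : α.mu (c • a) = c • α.mu a := α.muL.map_smul c a

/-- The subspace of all `f` for which `f u_g` lies in a given space `R` of operators. -/
noncomputable def monomialComap (g : G) (R : Submodule ℂ (α.H →L[ℂ] α.H)) : Submodule ℂ A :=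
  R.comap ((LinearMap.mulRight ℂ (α.u g)).comp α.muL)

theorem isClosed_monomialComap (g : G) {R : Submodule ℂ (α.H →L[ℂ] α.H)}
    (hR : IsClosed (R : Set (α.H →L[ℂ] α.H))) : IsClosed (α.monomialComap g R : Set A) :=
  hR.preimage (α.continuous_mu.mul continuous_const)

theorem weight_one (f : A) (χ : WeakDual.characterSpace ℂ A) : α.weight f (1, χ) = χ f := by
  have h1 : ∀ k : G, k = 1 → χ ∈ α.U k := by
    rintro _ rfl
    have : ∃ a, χ a ≠ 0 := by
      by_contra! h
      exact χ.2.1 (ContinuousLinearMap.ext h)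
    obtain ⟨a, ha⟩ := this
    exact ⟨a, by rw [α.ideal_one]; trivial, ha⟩
  simp only [weight, dif_pos (h1 1⁻¹ inv_one)]
  congr 1
  refine (α.dual_unique 1 χ (h1 1⁻¹ inv_one) χ fun a => ?_).symm
  rw [α.act_one]

end Covariance

section Unital

variable {G A : Type*} [Group G] [CommCStarAlgebra A] (α : PartialAction G A)

/-- The representation `μ` is isometric, because its fibre over `1 ∈ G` is the Gelfand
transform. -/
theorem norm_mu (f : A) : ‖α.mu f‖ = ‖f‖ := by
  refine le_antisymm (α.norm_mu_le f) ?_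
  have h := (gelfandTransform_isometry A).norm_map_of_map_zero (map_zero _) f
  rw [← h]
  refine (ContinuousMap.norm_le _ (norm_nonneg _)).2 fun χ => ?_
  change ‖χ f‖ ≤ _
  have h1 := (α.mu f).le_opNorm (delta (1, χ))
  rw [mu_delta, norm_smul, orthonormal_delta.1, mul_one, mul_one] at h1
  rw [← α.weight_one f χ]
  exact h1

end Unital

end PartialAction

/-! ### The operators on `ℓ²(G × X)` that correspond to `I_V` -/

section Graph

variable {G : Type*} [Group G] {P : Subsemigroup G}

/-- The source projection `S* S` of an operator of degree `g`, as an element of `D_{g⁻¹}`. -/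
noncomputable def sourceProj {S : L2 P →L[ℂ] L2 P} {g : G} (h : HasDegree P S g) :
    (partialAction P).ideal g⁻¹ :=
  ⟨DAlg.mk (star S * S) h.star_mul_self.mem_diagonal,
    mem_ideal.2 (HasDegree.mem_idealSpace (by rwa [inv_inv]))⟩

theorem val_sourceProj {S : L2 P →L[ℂ] L2 P} {g : G} (h : HasDegree P S g) :
    DAlg.val (sourceProj h : DAlg P) = star S * S := rfl

theorem val_act (g : G) (d : (partialAction P).ideal g⁻¹) :
    DAlg.val ((partialAction P).act g d : DAlg P) = conj P g (DAlg.val (d : DAlg P)) := rfl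

/-- The operator `S S* u_g = λ_g S* S` on `ℓ²(G × X)` that corresponds to an operator `S` of
degree `g`. -/
noncomputable def image {S : L2 P →L[ℂ] L2 P} {g : G} (h : HasDegree P S g) :
    (partialAction P).H →L[ℂ] (partialAction P).H :=
  (partialAction P).lam g * (partialAction P).mu (sourceProj h : DAlg P)

theorem image_eq {S : L2 P →L[ℂ] L2 P} {g : G} (h : HasDegree P S g) :
    image h = (partialAction P).mu
      ((partialAction P).act g (sourceProj h) : DAlg P) * (partialAction P).u g :=
  ((partialAction P).mu_act_mul_u g _).symm

theorem image_hasDegree_V (p : P) : image (hasDegree_V p) =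
    (partialAction P).mu (rangeProj P p : DAlg P) * (partialAction P).u (p : G) := by
  rw [image_eq]
  congr 2
  exact DAlg.ext (hasDegree_V p).conj_eq

theorem HasDegree.conj_star_mul_mul {T : L2 P →L[ℂ] L2 P} {h : G} (hT : HasDegree P T h)
    {d : L2 P →L[ℂ] L2 P} (hd : d ∈ diagonal P) :
    conj P h (Star.star T * d * T) = d * (T * Star.star T) := by
  have h1 := hT.compr_mul
  have h2 := congrArg Star.star h1
  simp only [star_mul, star_star] at h2
  have h3 := congrArg Star.star hT.mul_star_mul
  simp only [star_mul, star_star] at h3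
  have hTT : T * Star.star T ∈ diagonal P := by
    simpa using hT.star.star_mul_self.mem_diagonal
  calc conj P h (Star.star T * d * T)
      = compr P h * (Star.star T * T * Star.star T) * d * (T * (Star.star T * T)) *
          Star.star (compr P h) := by
        rw [hT.mul_star_mul, h3]; simp only [conj, mul_assoc]
    _ = (compr P h * (Star.star T * T)) * Star.star T * d * T *
          (Star.star T * T * Star.star (compr P h)) := by simp only [mul_assoc]
    _ = d * (T * (Star.star T * T) * Star.star T) := by
        rw [h1, h2, diagonal_comm hTT hd]; simp only [mul_assoc]
    _ = d * (T * Star.star T) := by rw [hT.mul_star_mul]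

/-- The map `S ↦ S S* u_g` is multiplicative: both sides are `λ_{gh}` times a function in `D_{h⁻¹}`,
and `α_h` maps `T* S* S T` to `S* S · T T*`. -/
theorem image_mul {S T : L2 P →L[ℂ] L2 P} {g h : G} (hS : HasDegree P S g)
    (hT : HasDegree P T h) : image (hS.mul hT) = image hS * image hT := by
  have hd := hS.star_mul_self.mem_diagonal
  -- `(S T)* S T = T* S* S T` lies in `D_{h⁻¹}` as well as in `D_{(g h)⁻¹}`
  have hmem : DAlg.val (sourceProj (hS.mul hT) : DAlg P) ∈ idealSpace P h⁻¹ := by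
    have h1 : DAlg.val (sourceProj (hS.mul hT) : DAlg P) =
        (star (S * T) * (S * T)) * (star T * T) := by
      rw [val_sourceProj]
      simp only [mul_assoc, hT.mul_star_mul]
    rw [h1]
    exact mul_mem_idealSpace (hS.mul hT).star_mul_self.mem_diagonal
      (mem_ideal.1 (sourceProj hT).2)
  refine ((partialAction P).lam_mul_mu_mul g h (sourceProj hS : DAlg P) (sourceProj hT)
    ⟨(sourceProj (hS.mul hT) : DAlg P), mem_ideal.2 hmem⟩ (DAlg.ext ?_)).symm
  rw [map_mul, val_act, val_act, val_sourceProj, val_sourceProj, val_sourceProj, hT.conj_eq,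
    ← hT.conj_star_mul_mul hd, star_mul]
  simp only [mul_assoc]

theorem image_star {S : L2 P →L[ℂ] L2 P} {g : G} (hS : HasDegree P S g) :
    image hS.star = star (image hS) := by
  rw [image, image, PartialAction.star_lam_mul_mu]
  · congr 2
    refine DAlg.ext ?_
    rw [val_act, val_sourceProj, val_sourceProj, hS.conj_eq, star_star]
  · -- the weight of a projection is idempotent, hence `0` or `1`
    intro x
    have h1 : (sourceProj hS : DAlg P) = sourceProj hS * sourceProj hS := by
      refine DAlg.ext ?_
      rw [map_mul, val_sourceProj, mul_assoc, hS.mul_star_mul]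
    have h2 := (partialAction P).weight_mul (sourceProj hS : DAlg P) (sourceProj hS : DAlg P) x
    rw [← h1] at h2
    rcases eq_or_ne ((partialAction P).weight (sourceProj hS : DAlg P) x) 0 with h | h
    · rw [h, star_zero]
    · rw [(mul_eq_left₀ h).1 h2.symm, star_one]

/-! ### The C*-algebra generated by the pairs -/

variable (P) in
/-- Pairs of operators, on `ℓ²(P)` and on `ℓ²(G × X)`. -/
abbrev OpPair : Type _ :=
  Op P × Op (G × WeakDual.characterSpace ℂ (DAlg P))

variable (P) in
/-- The pairs `(S, S S* u_g)`, where `S` runs through the operators of degree `g` and `g`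
through `G`. -/
noncomputable def pairs :
    Set (OpPair P) :=
  {c | ∃ S g, ∃ h : HasDegree P S g, c = (S, image h)}

variable (P) in
/-- The C*-algebra generated by the pairs `(S, S S* u_g)`. It is the graph of the isomorphism of
`C*_λ(P)` with the crossed product. -/
noncomputable def graph : NonUnitalStarSubalgebra ℂ (OpPair P) :=
  (NonUnitalStarAlgebra.adjoin ℂ (pairs P)).topologicalClosure

theorem mem_graph {S : L2 P →L[ℂ] L2 P} {g : G} (h : HasDegree P S g) :
    (S, image h) ∈ graph P :=
  NonUnitalStarSubalgebra.le_topologicalClosure _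
    (NonUnitalStarAlgebra.subset_adjoin ℂ _ ⟨S, g, h, rfl⟩)

instance isClosed_graph : IsClosed (graph P : Set (OpPair P)) :=
  NonUnitalStarSubalgebra.isClosed_topologicalClosure _

theorem adjoin_pairs_le_span {c : OpPair P}
    (hc : c ∈ NonUnitalStarAlgebra.adjoin ℂ (pairs P)) : c ∈ Submodule.span ℂ (pairs P) := by
  induction hc using NonUnitalStarAlgebra.adjoin_induction with
  | mem x hx => exact Submodule.subset_span hx
  | add x y _ _ hx hy => exact add_mem hx hy
  | zero => exact zero_mem _
  | smul r x _ hx => exact Submodule.smul_mem _ r hx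
  | mul x y _ _ hx hy =>
    refine Submodule.span_induction₂ (p := fun a b _ _ => a * b ∈ Submodule.span ℂ (pairs P))
      ?_ ?_ ?_ ?_ ?_ ?_ ?_ hx hy
    · rintro _ _ ⟨S, g, hS, rfl⟩ ⟨T, h, hT, rfl⟩
      exact Submodule.subset_span ⟨_, g * h, hS.mul hT, Prod.ext rfl (image_mul hS hT).symm⟩
    · intro y _; rw [zero_mul]; exact zero_mem _
    · intro y _; rw [mul_zero]; exact zero_mem _
    · intro x y z _ _ _ h1 h2; rw [add_mul]; exact add_mem h1 h2
    · intro x y z _ _ _ h1 h2; rw [mul_add]; exact add_mem h1 h2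
    · intro r x y _ _ h; rw [smul_mul_assoc]; exact Submodule.smul_mem _ r h
    · intro r x y _ _ h; rw [mul_smul_comm]; exact Submodule.smul_mem _ r h
  | star x hx₀ hx =>
    clear hx₀
    induction hx using Submodule.span_induction with
    | mem x hx =>
      obtain ⟨S, g, hS, rfl⟩ := hx
      exact Submodule.subset_span ⟨_, g⁻¹, hS.star, Prod.ext rfl (image_star hS).symm⟩
    | zero => rw [star_zero]; exact zero_mem _
    | add x y _ _ hx hy => rw [star_add]; exact add_mem hx hy
    | smul r x _ hx => rw [star_smul]; exact Submodule.smul_mem _ _ hx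

/-- On the span of the pairs, the expectations onto the diagonals are intertwined by `μ`. -/
theorem exists_expect_eq {c : OpPair P}
    (hc : c ∈ Submodule.span ℂ (pairs P)) :
    ∃ d : DAlg P, d.val = expect P c.1 ∧ (partialAction P).mu d = expect _ c.2 := by
  induction hc using Submodule.span_induction with
  | mem c hc =>
    obtain ⟨S, g, hS, rfl⟩ := hc
    by_cases hg : g = 1
    · subst hg
      refine ⟨(sourceProj hS : DAlg P), ?_, ?_⟩
      · rw [val_sourceProj, hS.star_mul_self_eq]
        exact (expect_of_mem hS.mem_ellInfty).symm
      · have h1 : image hS = (partialAction P).mu (sourceProj hS : DAlg P) :=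
          ext_delta fun x => by
            rw [image, mul_app, PartialAction.mu_delta, map_smul, PartialAction.lam_delta, one_mul]
        change _ = expect _ (image hS)
        rw [h1]
        exact (expect_of_mem ⟨_, rfl⟩).symm
    · refine ⟨0, ?_, ?_⟩
      · rw [map_zero]; exact (hS.expect_eq_zero hg).symm
      · rw [PartialAction.mu_zero]
        refine ext_delta fun x => ?_
        change _ = expect _ (image hS) _
        rw [expect_apply, mulOp_delta, diagEntries_apply, image, mul_app, PartialAction.mu_delta,
          map_smul, PartialAction.lam_delta, lp.coeFn_smul, Pi.smul_apply, delta_ne]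
        · simp
        · intro h
          exact hg (by simpa using congrArg Prod.fst h)
  | zero => exact ⟨0, by simp, by rw [PartialAction.mu_zero, Prod.snd_zero, map_zero]⟩
  | add x y _ _ hx hy =>
    obtain ⟨d, h1, h2⟩ := hx
    obtain ⟨e, h3, h4⟩ := hy
    refine ⟨d + e, by simp [h1, h3], ?_⟩
    rw [PartialAction.mu_add, h2, h4, Prod.snd_add, map_add]
  | smul r x _ hx =>
    obtain ⟨d, h1, h2⟩ := hx
    refine ⟨r • d, by simp [h1], ?_⟩
    rw [PartialAction.mu_smul, h2, Prod.smul_snd, map_smul]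

/-- The two expectations of an element of the graph have the same norm. -/
theorem norm_expect_eq {c : OpPair P}
    (hc : c ∈ graph P) : ‖expect P c.1‖ = ‖expect _ c.2‖ := by
  have hclosed : IsClosed {c : OpPair P | ‖expect P c.1‖ = ‖expect _ c.2‖} :=
    isClosed_eq ((expect P).continuous.comp continuous_fst).norm
      ((expect _).continuous.comp continuous_snd).norm
  refine closure_minimal (fun c hc => ?_) hclosed hc
  obtain ⟨d, h1, h2⟩ := exists_expect_eq (adjoin_pairs_le_span hc)
  change ‖expect P c.1‖ = ‖expect _ c.2‖
  rw [← h1, ← h2, PartialAction.norm_mu]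
  rfl

/-! ### The isomorphism and its uniqueness -/

/-- If the first component vanishes, then so does the expectation of `c* c` in both components, and
the second component is zero because the expectation is faithful. -/
theorem snd_eq_zero {c : OpPair P} (hc : c ∈ graph P) (h : c.1 = 0) : c.2 = 0 := by
  have h1 := norm_expect_eq (mul_mem (star_mem hc) hc)
  refine eq_zero_of_expect_star_mul_self (norm_eq_zero.1 (h1.symm.trans ?_))
  rw [Prod.fst_mul, h, mul_zero, map_zero, norm_zero]

theorem fst_eq_zero {c : OpPair P} (hc : c ∈ graph P) (h : c.2 = 0) : c.1 = 0 := by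
  have h1 := norm_expect_eq (mul_mem (star_mem hc) hc)
  refine eq_zero_of_expect_star_mul_self (norm_eq_zero.1 (h1.trans ?_))
  rw [Prod.snd_mul, h, mul_zero, map_zero, norm_zero]

theorem isClosed_graph_fst :
    IsClosed ((graph P).map (NonUnitalStarAlgHom.fst ℂ _ _) : Set (L2 P →L[ℂ] L2 P)) :=
  isClosed_map_fst isClosed_graph fun _ => snd_eq_zero

theorem isClosed_graph_snd :
    IsClosed ((graph P).map (NonUnitalStarAlgHom.snd ℂ _ _) :
      Set ((partialAction P).H →L[ℂ] (partialAction P).H)) :=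
  isClosed_map_snd isClosed_graph fun _ => fst_eq_zero

theorem graph_le {B : NonUnitalStarSubalgebra ℂ (OpPair P)} (hB : IsClosed (B : Set (OpPair P)))
    (h : ∀ S g, ∀ hS : HasDegree P S g, (S, image hS) ∈ B) : graph P ≤ B :=
  NonUnitalStarSubalgebra.topologicalClosure_minimal _
    (NonUnitalStarAlgebra.adjoin_le (by rintro _ ⟨S, g, hS, rfl⟩; exact h S g hS)) hB

/-- The algebra `C*_λ(P)` is the closed linear span of the operators that have a degree. -/
theorem reducedCStar_subset {K : Submodule ℂ (L2 P →L[ℂ] L2 P)}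
    (hK : IsClosed (K : Set (L2 P →L[ℂ] L2 P))) (h : ∀ S g, HasDegree P S g → S ∈ K)
    {T : L2 P →L[ℂ] L2 P} (hT : T ∈ reducedCStar P) : T ∈ K := by
  -- for empty `P` no operator has a degree, but `ℓ²(P) = 0`
  rcases isEmpty_or_nonempty P with hP | hP
  · rw [show T = 0 from ext_delta fun x => hP.elim x]
    exact zero_mem _
  · refine closure_minimal (fun S hS => ?_) hK hT
    exact Submodule.span_le.2 (by rintro S ⟨g, hS⟩; exact h S g hS) (adjoin_le_span hS)

/-- The first projection of the graph is `C*_λ(P)`. -/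
theorem mem_reducedCStar_iff (T : L2 P →L[ℂ] L2 P) :
    T ∈ reducedCStar P ↔ ∃ R, (T, R) ∈ graph P := by
  constructor
  · intro hT
    obtain ⟨c, hc, rfl⟩ := reducedCStar_subset
      (K := ((graph P).map (NonUnitalStarAlgHom.fst ℂ _ _)).toNonUnitalSubalgebra.toSubmodule)
      isClosed_graph_fst (fun S _ hS => ⟨_, mem_graph hS, rfl⟩) hT
    exact ⟨c.2, hc⟩
  · rintro ⟨R, hR⟩
    exact graph_le (B := NonUnitalStarSubalgebra.comap (NonUnitalStarAlgHom.fst ℂ _ _)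
      (reducedCStar P).toNonUnitalStarSubalgebra) (isClosed_reducedCStar.preimage continuous_fst)
      (fun S g hS => hS.mem) hR

/-- Every generator `f u_g` of the crossed product occurs as a second component: this holds for
`f = S* S` with `S` of degree `g⁻¹`, and these `f` span a dense subspace of `D_g`. -/
theorem exists_mem_graph_mu_mul_u (g : G) {f : DAlg P} (hf : f ∈ (partialAction P).ideal g) :
    ∃ c, (c, (partialAction P).mu f * (partialAction P).u g) ∈ graph P := by
  -- the `d ∈ D_λ(P)` for which `d u_g` is a second component form a closed subspace
  let R : Submodule ℂ ((partialAction P).H →L[ℂ] (partialAction P).H) :=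
    ((graph P).map (NonUnitalStarAlgHom.snd ℂ _ _)).toNonUnitalSubalgebra.toSubmodule
  let K : Submodule ℂ (DAlg P) := (partialAction P).monomialComap g R
  have hK : IsClosed (K : Set (DAlg P)) :=
    (partialAction P).isClosed_monomialComap g isClosed_graph_snd
  have hval : Topology.IsClosedEmbedding (DAlg.val : DAlg P → L2 P →L[ℂ] L2 P) :=
    (isClosed_diagonal (P := P)).isClosedEmbedding_subtypeVal
  have hmem : f.val ∈ K.map (DAlg.val : DAlg P →⋆ₐ[ℂ] _).toAlgHom.toLinearMap := by
    refine idealSpace_induction (ContinuousLinearMap.id ℂ _) _ (hval.isClosedMap _ hK)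
      (fun S hS _ => ?_) (mem_ideal.1 hf)
    have hS' : HasDegree P (star S) g := by simpa using hS.star
    refine ⟨((partialAction P).act g (sourceProj hS') : DAlg P), ⟨_, mem_graph hS', ?_⟩, ?_⟩
    · exact image_eq hS'
    · change DAlg.val _ = _
      rw [val_act, val_sourceProj, hS'.conj_eq, star_star]
      rfl
  obtain ⟨d, hdK, hd⟩ := hmem
  rw [DAlg.ext hd] at hdK
  obtain ⟨c, hc, h⟩ := hdK
  have hc' : c = (c.1, (partialAction P).mu f * (partialAction P).u g) := Prod.ext rfl h
  exact ⟨c.1, hc' ▸ hc⟩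

/-- The second projection of the graph is `D_λ(P) ⋊_r G`. -/
theorem mem_reducedCrossedProduct_iff (T : (partialAction P).H →L[ℂ] (partialAction P).H) :
    T ∈ (partialAction P).reducedCrossedProduct ↔ ∃ S, (S, T) ∈ graph P := by
  constructor
  · intro hT
    have hle : (partialAction P).reducedCrossedProduct ≤
        (graph P).map (NonUnitalStarAlgHom.snd ℂ _ _) := by
      refine NonUnitalStarSubalgebra.topologicalClosure_minimal _
        (NonUnitalStarAlgebra.adjoin_le ?_) isClosed_graph_snd
      rintro _ ⟨g, f, hf, rfl⟩
      obtain ⟨c, hc⟩ := exists_mem_graph_mu_mul_u g hf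
      exact ⟨_, hc, rfl⟩
    obtain ⟨c, hc, rfl⟩ := hle hT
    exact ⟨c.1, hc⟩
  · rintro ⟨S, hS⟩
    refine graph_le (B := NonUnitalStarSubalgebra.comap (NonUnitalStarAlgHom.snd ℂ _ _)
      (partialAction P).reducedCrossedProduct)
      ((NonUnitalStarSubalgebra.isClosed_topologicalClosure _).preimage continuous_snd)
      (fun S g hS => ?_) hS
    change image hS ∈ (partialAction P).reducedCrossedProduct
    rw [image_eq]
    exact ((partialAction P).monomial g _).2

variable (P) in
theorem exists_starAlgEquiv :
    ∃ φ : reducedCStar P ≃⋆ₐ[ℂ] (partialAction P).reducedCrossedProduct,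
      ∀ p : P, φ (genV P p) = (partialAction P).monomial (p : G) (rangeProj P p) := by
  refine (exists_starAlgEquiv_of_graph (C := graph P) (fun _ => snd_eq_zero)
    (fun _ => fst_eq_zero) mem_reducedCStar_iff mem_reducedCrossedProduct_iff).imp
    fun φ hφ p => hφ _ _ ?_
  change (V P p, (partialAction P).mu (rangeProj P p : DAlg P) * (partialAction P).u (p : G)) ∈ _
  rw [← image_hasDegree_V]
  exact mem_graph _

/-- A *-isomorphism on `C*_λ(P)` is determined by its values on the isometries `V_p`. -/
theorem starAlgEquiv_ext
    {B : NonUnitalStarSubalgebra ℂ ((partialAction P).H →L[ℂ] (partialAction P).H)}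
    (hB : IsClosed (B : Set ((partialAction P).H →L[ℂ] (partialAction P).H)))
    {φ ψ : reducedCStar P ≃⋆ₐ[ℂ] B} (h : ∀ p, φ (genV P p) = ψ (genV P p)) : φ = ψ := by
  obtain ⟨K, hK, hmem⟩ := exists_mem_iff_apply_eq isClosed_reducedCStar hB φ ψ
  have hV : ∀ p, V P p ∈ K := fun p => (hmem (genV P p)).2 (h p)
  have hdeg : ∀ S g, HasDegree P S g → S ∈ K := by
    intro S g hS
    induction hS with
    | base p q => exact mul_mem (star_mem (hV p)) (hV q)
    | mul _ _ h1 h2 => exact mul_mem h1 h2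
  exact StarAlgEquiv.ext fun T => (hmem T).1
    (reducedCStar_subset (K := K.toNonUnitalSubalgebra.toSubmodule) hK hdeg T.2)

end Graph

end SemigroupCStar

theorem mainTheorem11 {G : Type*} [Group G] (P : Subsemigroup G) :
    ∃! φ : SemigroupCStar.reducedCStar P ≃⋆ₐ[ℂ]
        (SemigroupCStar.partialAction P).reducedCrossedProduct,
      ∀ p : P, φ (SemigroupCStar.genV P p) =
        (SemigroupCStar.partialAction P).monomial (p : G) (SemigroupCStar.rangeProj P p) := by
  exact existsUnique_of_exists_of_unique (SemigroupCStar.exists_starAlgEquiv P)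
    fun φ ψ hφ hψ => SemigroupCStar.starAlgEquiv_ext
      (NonUnitalStarSubalgebra.isClosed_topologicalClosure _) fun p => (hφ p).trans (hψ p).symm
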